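/- **Setting.** Let $0<b<\infty$ and let $H:(0,b)\to\mathbb R^{2\times2}$ be integrable with $H(x)\ge0$, $H(x)\neq0$ and $\operatorname{tr}H(x)=1$ for a.e. $x\in(0,b)$. Put $\mathcal J=\begin{pmatrix}0&-1\\1&0\end{pmatrix}$. Let $L^2_H(b)$ be the Hilbert space of (classes of) measurable $f:(0,b)\to\mathbb C^2$ with $\int_0^b f^*Hf\,dx<\infty$ and inner product $\langle f,g\rangle=\int_0^b f^*Hg\,dx$. Let $A_b$ be the linear relation of all $\{f,g\}\in L^2_H(b)\oplus L^2_H(b)$ such that $f$ has a representative $\mathring f$, absolutely continuous on $[0,b]$, with $\mathcal J\mathring f'=-Hg$ a.e. on $(0,b)$ and $\mathring f_2(0)=0$. For $\gamma\in[0,\pi)$ let $A_b^\gamma$ be its restriction by the boundary condition $\mathring f_1(b)\sin\gamma-\mathring f_2(b)\cos\gamma=0$, and let $\sigma(A_b^\gamma)$ be its spectrum. For $z\in\mathbb C$ let $u(z,\cdot)$ be the solution on $[0,b]$ of $\mathcal Ju'=-zHu$, $u(z,0)=(1,0)^t$. Let $\mathcal B_b$ be the space of the functions $(Uf)(z)=\int_0^b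 u(z,x)^tH(x)f(x)\,dx$, where $f$ runs over the closure of $\operatorname{dom}A_b$ in $L^2_H(b)$, with $\langle Uf,Ug\rangle_{\mathcal B_b}=\langle f,g\rangle$, and let $K_b(z,w)$ be its reproducing kernel. For $a\in[0,b)$ and $\omega:[a,b]\to\mathbb R$ absolutely continuous with $\omega(a)=1$, $\omega(b)=0$, put $$J_{ab;\omega}(z,w)=\big\langle u(\bar z,\cdot),\,R_{ab;\omega}\,u(\bar w,\cdot)\big\rangle,\qquad R_{ab;\omega}=\chi_{[0,a]}+\omega\,\chi_{(a,b]} .$$ **Proposition 4.1.** Suppose that there are an interval $[x_1,x_2]\subset[0,b]$ and a constant $g_0\in(-\tfrac12,\tfrac12)$ such that $$H(x)=\begin{pmatrix}\tfrac12+g_0&0\\0&\tfrac12-g_0\end{pmatrix}\qquad\text{for a.e. }x\in[x_1,x_2]$$ (so that every point of $[x_1,x_2]$ is a regular point of $H$, that is, lies in no singular interval). Let $a\in[x_1,x_2)$ and $c\in(a,x_2]$, and let $$\omega(x)=\begin{cases}\dfrac{c-x}{c-a},&x\in[a,c],\\[2mm]0,&x\in(c,b].\end{cases}$$ Then for every $\gamma\in[0,\pi)$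 (in particular for every $\gamma$ for which the extension is not exceptional) the series $$\sum_{\lambda\in\sigma(A_b^\gamma)}\frac{|J_{ab;\omega}(z,\lambda)|}{K_b(\lambda,\lambda)^{1/2}}$$ converges for every $z\in\mathbb C$, uniformly on every compact subset of $\mathbb C$. -/

import Mathlib

open MeasureTheory Set Filter Topology

namespace CanonicalSystem

noncomputable section

/-- Vector-valued functions of a real variable. Only their restriction to the interval under
consideration matters. -/
abbrev Fn := ℝ → Fin 2 → ℂ

/-- The symplectic matrix `𝓙 = (0 -1; 1 0)`. -/
def Jmat : Matrix (Fin 2) (Fin 2) ℂ := !![0, -1; 1, 0]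

/-- The value of a real matrix function, regarded as a complex matrix. -/
def cplx (H : ℝ → Matrix (Fin 2) (Fin 2) ℝ) (x : ℝ) : Matrix (Fin 2) (Fin 2) ℂ :=
  (H x).map Complex.ofReal

/-- The class `𝓒(l)` of Hamiltonians on `(0, l)`: integrable, almost everywhere non-negative,
non-zero, and trace-normalized. -/
structure IsHamiltonian (H : ℝ → Matrix (Fin 2) (Fin 2) ℝ) (l : ℝ) : Prop where
  integrable : ∀ i j, IntegrableOn (fun x => H x i j) (Ioo 0 l)
  nonneg : ∀ᵐ x ∂volume.restrict (Ioo 0 l), (H x).PosSemidef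
  ne_zero : ∀ᵐ x ∂volume.restrict (Ioo 0 l), H x ≠ 0
  trace_eq_one : ∀ᵐ x ∂volume.restrict (Ioo 0 l), (H x).trace = 1

/-! ### The space `L²_H(l)`

Its elements are represented by functions; two functions represent the same element when their
difference has norm zero (`EqL2`). -/

/-- `f` represents an element of `L²_H(l)`. -/
def MemL2 (H : ℝ → Matrix (Fin 2) (Fin 2) ℝ) (l : ℝ) (f : Fn) : Prop :=
  AEStronglyMeasurable f (volume.restrict (Ioo 0 l)) ∧
    IntegrableOn (fun x => star (f x) ⬝ᵥ (cplx H x).mulVec (f x)) (Ioo 0 l)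

/-- The inner product `∫₀ˡ f(x)* H(x) g(x) dx` of `L²_H(l)`, linear in the second argument. -/
def innerL2 (H : ℝ → Matrix (Fin 2) (Fin 2) ℝ) (l : ℝ) (f g : Fn) : ℂ :=
  ∫ x in Ioo 0 l, star (f x) ⬝ᵥ (cplx H x).mulVec (g x)

/-- The norm of `L²_H(l)`. -/
def normL2 (H : ℝ → Matrix (Fin 2) (Fin 2) ℝ) (l : ℝ) (f : Fn) : ℝ :=
  √(innerL2 H l f f).re

/-- `f` and `g` represent the same element of `L²_H(l)`. -/
def EqL2 (H : ℝ → Matrix (Fin 2) (Fin 2) ℝ) (l : ℝ) (f g : Fn) : Prop :=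
  normL2 H l (f - g) = 0

/-! ### The linear relations -/

/-- `f₀` is absolutely continuous on `[0, l]` and `𝓙 f₀' = - H g` almost everywhere on `(0, l)`. -/
def SolvesWith (H : ℝ → Matrix (Fin 2) (Fin 2) ℝ) (l : ℝ) (f₀ g : Fn) : Prop :=
  AbsolutelyContinuousOnInterval f₀ 0 l ∧
    ∀ᵐ x ∂volume.restrict (Ioo 0 l),
      ∃ v, HasDerivAt f₀ v x ∧ Jmat.mulVec v = -(cplx H x).mulVec (g x)

/-- `f₀` is an absolutely continuous representative of `f` that witnesses `{f, g} ∈ A_l`. -/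
structure IsWitness (H : ℝ → Matrix (Fin 2) (Fin 2) ℝ) (l : ℝ) (f g f₀ : Fn) : Prop where
  mem_left : MemL2 H l f
  mem_right : MemL2 H l g
  rep : EqL2 H l f f₀
  solves : SolvesWith H l f₀ g
  init : f₀ 0 1 = 0

/-- The linear relation `A_l`, as a set of pairs of representatives. -/
def relA (H : ℝ → Matrix (Fin 2) (Fin 2) ℝ) (l : ℝ) : Set (Fn × Fn) :=
  {p | ∃ f₀, IsWitness H l p.1 p.2 f₀}

/-- The self-adjoint relation `A_l^γ`, the restriction of `A_l` by the boundary condition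
`f₁(l) sin γ - f₂(l) cos γ = 0`. -/
def relAγ (H : ℝ → Matrix (Fin 2) (Fin 2) ℝ) (l γ : ℝ) : Set (Fn × Fn) :=
  {p | ∃ f₀, IsWitness H l p.1 p.2 f₀ ∧
    f₀ l 0 * (Real.sin γ : ℂ) - f₀ l 1 * (Real.cos γ : ℂ) = 0}

/-- The resolvent set of a linear relation `T` in `L²_H(l)`: the `z` for which `(T - z)⁻¹` is an
everywhere defined, single-valued, bounded operator. Here `{f, h} ∈ T - z` means
`{f, h + z f} ∈ T`. Single-valuedness is part of the bound, since `T - z` is linear. -/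
def resolventSet (H : ℝ → Matrix (Fin 2) (Fin 2) ℝ) (l : ℝ) (T : Set (Fn × Fn)) : Set ℂ :=
  {z | ∃ C : ℝ, ∀ h, MemL2 H l h →
    (∃ f, (f, h + z • f) ∈ T) ∧ ∀ f, (f, h + z • f) ∈ T → normL2 H l f ≤ C * normL2 H l h}

/-- The spectrum `σ(A_l^γ)`. -/
def spectrumA (H : ℝ → Matrix (Fin 2) (Fin 2) ℝ) (l γ : ℝ) : Set ℂ :=
  (resolventSet H l (relAγ H l γ))ᶜ

/-! ### The fundamental solution and the de Branges space -/

/-- `y` solves `𝓙 y' = - z H y` on `(0, b)` with `y(0) = (1, 0)`. -/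
def IsFundamental (H : ℝ → Matrix (Fin 2) (Fin 2) ℝ) (b : ℝ) (z : ℂ) (y : Fn) : Prop :=
  SolvesWith H b y (z • y) ∧ y 0 = ![1, 0]

/-- The solution `u(z, ·)` on `[0, b]` of `𝓙 y' = - z H y`, `y(0) = (1, 0)`. It exists and is
unique on `[0, b]` for every Hamiltonian; values outside `[0, b]` are irrelevant. -/
def u (H : ℝ → Matrix (Fin 2) (Fin 2) ℝ) (b : ℝ) (z : ℂ) : Fn :=
  Classical.epsilon (IsFundamental H b z)

/-- The transform `(U f)(z) = ∫₀ᵇ u(z, x)ᵗ H(x) f(x) dx`. -/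
def U (H : ℝ → Matrix (Fin 2) (Fin 2) ℝ) (b : ℝ) (f : Fn) (z : ℂ) : ℂ :=
  ∫ x in Ioo 0 b, u H b z x ⬝ᵥ (cplx H x).mulVec (f x)

/-- The closure of `dom A_b` in `L²_H(b)`. -/
def closureDomA (H : ℝ → Matrix (Fin 2) (Fin 2) ℝ) (b : ℝ) : Set Fn :=
  {f | MemL2 H b f ∧ ∀ ε > 0, ∃ p ∈ relA H b, normL2 H b (f - p.1) < ε}

/-- `K` is the reproducing kernel of the de Branges space
`𝓑_b = {U f : f ∈ closure (dom A_b)}`, whose inner product is `⟨U f, U g⟩ = ⟨f, g⟩` in `L²_H(b)`: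
for every `w` one has `K(·, w) ∈ 𝓑_b`, and `F(w) = ⟨K(·, w), F⟩` for all `F ∈ 𝓑_b`. -/
def IsReproducingKernel (H : ℝ → Matrix (Fin 2) (Fin 2) ℝ) (b : ℝ) (K : ℂ → ℂ → ℂ) : Prop :=
  ∀ w, ∃ k ∈ closureDomA H b, (fun z => K z w) = U H b k ∧
    ∀ f ∈ closureDomA H b, U H b f w = innerL2 H b k f

/-- The reproducing kernel `K_b(z, w)` of `𝓑_b`. -/
def K (H : ℝ → Matrix (Fin 2) (Fin 2) ℝ) (b : ℝ) : ℂ → ℂ → ℂ :=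
  Classical.epsilon (IsReproducingKernel H b)

/-- `R_{ab;ω} = χ_[0,a] + ω χ_(a,b]`, for arguments in `[0, b]`. -/
def R (a : ℝ) (ω : ℝ → ℝ) (x : ℝ) : ℝ := if x ≤ a then 1 else ω x

/-- The kernel `J_{ab;ω}(z, w) = ⟨u(z*, ·), R_{ab;ω} u(w*, ·)⟩` in `L²_H(b)`. -/
def Jker (H : ℝ → Matrix (Fin 2) (Fin 2) ℝ) (a b : ℝ) (ω : ℝ → ℝ) (z w : ℂ) : ℂ :=
  innerL2 H b (u H b (star z)) (fun x => (R a ω x : ℂ) • u H b (star w) x)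

/-- The piecewise linear cutoff: `(c - x) / (c - a)` on `[a, c]`, and `0` to the right of `c`. -/
def cutoff (a c : ℝ) (x : ℝ) : ℝ := if x ≤ c then (c - x) / (c - a) else 0

end

end CanonicalSystem

/-!
The terms of the series are Fourier coefficients. The points `μ` of the spectrum are real and the
functions `u(μ, ·)` are pairwise orthogonal in `L²_H(b)`, with `K_b(μ, μ) = ‖u(μ, ·)‖²` (`K_self`);
and `J(z, μ) = ⟨f, u(μ, ·)⟩` for the cut-off solution `f = R u(z*, ·)`. Bessel's inequality makes
the terms square summable, and two facts turn this into absolute convergence.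

* On `(a, c)`, the only place where the cutoff varies, `H` is the invertible matrix
  `diag(1/2 + g₀, 1/2 - g₀)`. So `f` solves `𝓙 f' = -H g` with `g = z* f - R' H⁻¹ 𝓙 u(z*, ·)`
  (`solvesWith_cutFn`). As `f` vanishes at `b`, Green's identity has no boundary term there and
  gives `⟨g, u(μ, ·)⟩ = μ ⟨f, u(μ, ·)⟩` (`green_cutFn`). Hence `(1 + μ²) |J(z, μ)|²` is
  `|⟨f, u(μ, ·)⟩|² + |⟨g, u(μ, ·)⟩|²`, and its sum, weighted by `1 / K_b(μ, μ)`, is at most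
  `‖f‖² + ‖g‖²`.
* `∑ 1 / (1 + μ²)` converges over the spectrum (`summable_weight`), that is, the resolvents are
  Hilbert–Schmidt. Indeed `u₂(μ, x)` and `1 - u₁(μ, x)` are `μ` times the pairings of `u(μ, ·)`
  with step functions of norm at most `√(2b)`, and the normalization `u₁(μ, 0) = 1` is itself
  controlled by two Fourier coefficients, through Green's identity for the cut-off of the constant
  solution `(0, 1)` for `z = 0` (`weight_le`). Bessel's inequality at each `x`, integrated over
  `(0, b)`, bounds `∑ (1 + μ²)⁻¹ ‖u(μ, ·)‖² / ‖u(μ, ·)‖²`.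

The Cauchy–Schwarz inequality now bounds the tails of the series by those of `∑ 1 / (1 + μ²)` times
`√(‖f‖² + ‖g‖²)`, which Gronwall's inequality bounds for `z` in a bounded set.

No property of the spectrum is needed beyond its inclusion in the set of real zeros of
`u₁(z, b) sin γ - u₂(z, b) cos γ`: away from the zeros the inhomogeneous boundary value problem is
solvable with an a priori bound (`mem_resolventSet_of_boundaryValue_ne_zero`), and Green's identity
makes the zeros real. The bounds on `H` come from trace normalization, so that the equation has
bounded measurable coefficients and a contraction argument provides the solutions.
-/

namespace CanonicalSystem

/-! ### Absolutely continuous functions and integral equations -/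

section Analysis

variable {E : Type*} [NormedAddCommGroup E] [NormedSpace ℝ E]

lemma ac_of_dist_le {X Y : Type*} [PseudoMetricSpace X] [PseudoMetricSpace Y] {f : ℝ → X}
    {g : ℝ → Y} {a b : ℝ} (C : ℝ) (hf : AbsolutelyContinuousOnInterval f a b)
    (h : ∀ x ∈ uIcc a b, ∀ y ∈ uIcc a b, dist (g x) (g y) ≤ C * dist (f x) (f y)) :
    AbsolutelyContinuousOnInterval g a b := by
  unfold AbsolutelyContinuousOnInterval at hf ⊢
  have hC := hf.const_mul C
  rw [mul_zero] at hC
  refine squeeze_zero' (Eventually.of_forall fun E => Finset.sum_nonneg fun _ _ => dist_nonneg)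
    ?_ hC
  filter_upwards [mem_inf_of_right (mem_principal_self _)] with I hI
  rw [Finset.mul_sum]
  exact Finset.sum_le_sum fun i hi => h _ (hI.1 i hi).1 _ (hI.1 i hi).2

lemma ac_primitive {v : ℝ → E} {a b : ℝ} (y₀ : E) (hv : IntervalIntegrable v volume a b) :
    AbsolutelyContinuousOnInterval (fun x => y₀ + ∫ t in a..x, v t) a b := by
  refine ac_of_dist_le 1
    (hv.norm.absolutelyContinuousOnInterval_intervalIntegral left_mem_uIcc) ?_
  intro x hx y hy
  have hx' : IntervalIntegrable v volume a x := hv.mono_set (uIcc_subset_uIcc_left hx)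
  have hy' : IntervalIntegrable v volume a y := hv.mono_set (uIcc_subset_uIcc_left hy)
  rw [dist_add_left, dist_eq_norm, intervalIntegral.integral_interval_sub_left hx' hy', one_mul,
    Real.dist_eq, intervalIntegral.integral_interval_sub_left hx'.norm hy'.norm]
  exact intervalIntegral.norm_integral_le_abs_integral_norm

lemma ac_eq_primitive [CompleteSpace E] {f v : ℝ → E} {a b : ℝ} (hab : a ≤ b)
    (hf : AbsolutelyContinuousOnInterval f a b) (hv : IntervalIntegrable v volume a b)
    (hd : ∀ᵐ x, x ∈ Ioo a b → HasDerivAt f (v x) x) {x : ℝ} (hx : x ∈ Icc a b) :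
    f x = f a + ∫ t in a..x, v t := by
  have hg := hf.sub (ac_primitive 0 hv)
  obtain ⟨C, hC⟩ := hg.const_of_ae_hasDerivAt_zero (by
    have h1 : ∀ᵐ x : ℝ, x ≠ a := by simp [ae_iff, measure_singleton]
    have h2 : ∀ᵐ x : ℝ, x ≠ b := by simp [ae_iff, measure_singleton]
    filter_upwards [hd, hv.ae_hasDerivAt_integral, h1, h2] with x hx1 hx2 hxa hxb hx
    have hx' := hx
    rw [uIcc_of_le hab] at hx'
    have := (hx1 ⟨lt_of_le_of_ne hx'.1 (Ne.symm hxa), lt_of_le_of_ne hx'.2 hxb⟩).sub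
      ((hx2 hx a left_mem_uIcc).const_add 0)
    simpa using this)
  rw [uIcc_of_le hab] at hC
  have e1 := hC x hx
  have e2 := hC a (left_mem_Icc.2 hab)
  simp only [Pi.sub_apply, zero_add, intervalIntegral.integral_same, sub_zero] at e1 e2
  rw [← e2] at e1
  rw [← e1]; abel

/-- The integral form of Gronwall's inequality. -/
lemma gronwall_integral {G : Type*} [NormedAddCommGroup G] {f : ℝ → G} {b δ M : ℝ} (hM : 0 ≤ M)
    (hf : ContinuousOn f (Icc 0 b))
    (h : ∀ x ∈ Icc 0 b, ‖f x‖ ≤ δ + M * ∫ t in (0 : ℝ)..x, ‖f t‖) :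
    ∀ x ∈ Icc 0 b, ‖f x‖ ≤ δ * Real.exp (M * x) := by
  intro x hx
  have hb : 0 ≤ b := hx.1.trans hx.2
  have hfn : ContinuousOn (fun t => ‖f t‖) (Icc 0 b) := hf.norm
  -- Outside `[0, b]` the function is extended by constants, so that its primitive is `C¹`.
  set φ : ℝ → ℝ := IccExtend hb ((Icc 0 b).domRestrict fun t => ‖f t‖) with hφ
  have hφc : Continuous φ := hfn.domRestrict.Icc_extend'
  have hφe : ∀ t ∈ Icc 0 b, φ t = ‖f t‖ := fun t ht => by
    rw [hφ, IccExtend_of_mem hb _ ht]; rfl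
  have hint : ∀ x ∈ Icc 0 b, ∫ t in (0 : ℝ)..x, ‖f t‖ = ∫ t in (0 : ℝ)..x, φ t := by
    intro x hx
    refine intervalIntegral.integral_congr fun t ht => ?_
    rw [uIcc_of_le hx.1] at ht
    exact (hφe t ⟨ht.1, ht.2.trans hx.2⟩).symm
  have hder : ∀ x, HasDerivAt (fun x => δ + M * ∫ t in (0 : ℝ)..x, φ t) (M * φ x) x := fun x =>
    ((intervalIntegral.integral_hasDerivAt_right (hφc.intervalIntegrable _ _)
      (hφc.stronglyMeasurableAtFilter _ _) hφc.continuousAt).const_mul M).const_add δ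
  have key := norm_le_gronwallBound_of_norm_deriv_right_le
    (f := fun x => δ + M * ∫ t in (0 : ℝ)..x, φ t) (f' := fun x => M * φ x) (δ := δ) (K := M)
    (ε := 0) (a := 0) (b := b) (fun x _ => (hder x).continuousAt.continuousWithinAt)
    (fun x _ => (hder x).hasDerivWithinAt) ?_ ?_ x hx
  · rw [gronwallBound_ε0, sub_zero] at key
    refine ((h x hx).trans ?_).trans key
    rw [hint x hx]
    exact le_abs_self _
  · have h0 := (norm_nonneg _).trans (h 0 (left_mem_Icc.2 hb))
    simp only [intervalIntegral.integral_same, mul_zero, add_zero] at h0 ⊢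
    rw [Real.norm_of_nonneg h0]
  · intro y hy
    have hy' : y ∈ Icc 0 b := ⟨hy.1, hy.2.le⟩
    have h1 := h y hy'
    rw [hint y hy', ← hφe y hy'] at h1
    have h0 : 0 ≤ φ y := by rw [hφe y hy']; positivity
    rw [add_zero, Real.norm_of_nonneg (mul_nonneg hM h0)]
    exact mul_le_mul_of_nonneg_left (h1.trans (le_abs_self _)) hM

/-- **Carathéodory existence**: the equation `f' = F(t, f)` has a continuous integral solution when
`F` is merely integrable in `t` and uniformly Lipschitz in `f`. -/
lemma exists_integral_solution [CompleteSpace E] {F : ℝ → E → E} {b M : ℝ} (hb : 0 ≤ b)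
    (hM : 0 ≤ M) (hF : ∀ g : ℝ → E, Continuous g →
      IntervalIntegrable (fun t => F t (g t)) volume 0 b)
    (hL : ∀ᵐ t, t ∈ Ioo 0 b → ∀ v w, ‖F t v - F t w‖ ≤ M * ‖v - w‖) (y₀ : E) :
    ∃ f : ℝ → E, Continuous f ∧ ∀ x ∈ Icc 0 b, f x = y₀ + ∫ t in (0 : ℝ)..x, F t (f t) := by
  -- With `f(t) = exp(Lt) g(t)` the Volterra operator becomes a contraction for the sup norm of `g`.
  set L : ℝ := 2 * M + 1 with hLdef
  have hLpos : 0 < L := by positivity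
  have hML : M / L ≤ 1 / 2 := by rw [div_le_iff₀ hLpos, hLdef]; linarith
  let ext : C(Icc (0 : ℝ) b, E) → ℝ → E := fun g t => Real.exp (L * t) • IccExtend hb g t
  have hext : ∀ g, Continuous (ext g) := fun g =>
    (by fun_prop : Continuous fun t : ℝ => Real.exp (L * t)).smul g.continuous.Icc_extend'
  have hint : ∀ g, IntervalIntegrable (fun t => F t (ext g t)) volume 0 b :=
    fun g => hF _ (hext g)
  have hsub : ∀ x ∈ Icc 0 b, uIcc 0 x ⊆ uIcc 0 b := fun x hx =>
    uIcc_subset_uIcc_left (by rwa [uIcc_of_le hb])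
  have hcont : ∀ g, ContinuousOn
      (fun x => Real.exp (-(L * x)) • (y₀ + ∫ t in (0 : ℝ)..x, F t (ext g t))) (Icc 0 b) := by
    intro g
    have h1 := (ac_primitive y₀ (hint g)).continuousOn
    rw [uIcc_of_le hb] at h1
    exact (by fun_prop : Continuous fun x : ℝ => Real.exp (-(L * x))).continuousOn.smul h1
  let T : C(Icc (0 : ℝ) b, E) → C(Icc (0 : ℝ) b, E) := fun g => ⟨_, (hcont g).domRestrict⟩
  have hT : ∀ g x, T g x = Real.exp (-(L * x)) • (y₀ + ∫ t in (0 : ℝ)..x, F t (ext g t)) :=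
    fun _ _ => rfl
  have hLip : LipschitzWith (1 / 2) T := by
    refine LipschitzWith.of_dist_le_mul fun g h => ?_
    rw [ContinuousMap.dist_le (by positivity)]
    intro x
    have hgi := (hint g).mono_set (hsub x x.2)
    have hhi := (hint h).mono_set (hsub x x.2)
    have hexpint : ∫ t in (0 : ℝ)..x, M * (Real.exp (L * t) * dist g h)
        = M * dist g h * ((Real.exp (L * x) - 1) / L) := by
      have : ∫ t in (0 : ℝ)..x, Real.exp (L * t) = (Real.exp (L * x) - 1) / L := by
        rw [intervalIntegral.integral_comp_mul_left (fun t => Real.exp t) hLpos.ne']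
        simp [integral_exp, div_eq_inv_mul]
      rw [← this, ← intervalIntegral.integral_const_mul]
      congr 1; ext t; ring
    have hnorm : ‖∫ t in (0 : ℝ)..x, (F t (ext g t) - F t (ext h t))‖
        ≤ ∫ t in (0 : ℝ)..x, M * (Real.exp (L * t) * dist g h) := by
      refine intervalIntegral.norm_integral_le_of_norm_le x.2.1 ?_
        (Continuous.intervalIntegrable (by fun_prop) _ _)
      have h2 : ∀ᵐ t : ℝ, t ≠ b := by simp [ae_iff, measure_singleton]
      filter_upwards [hL, h2] with t ht htb htx
      refine (ht ⟨htx.1, lt_of_le_of_ne (htx.2.trans x.2.2) htb⟩ _ _).trans ?_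
      refine mul_le_mul_of_nonneg_left ?_ hM
      change ‖Real.exp (L * t) • _ - Real.exp (L * t) • _‖ ≤ _
      rw [← smul_sub, norm_smul, Real.norm_of_nonneg (Real.exp_pos _).le, ← dist_eq_norm]
      refine mul_le_mul_of_nonneg_left ?_ (Real.exp_pos _).le
      exact ContinuousMap.dist_apply_le_dist _
    rw [dist_eq_norm, hT, hT, ← smul_sub, add_sub_add_left_eq_sub,
      ← intervalIntegral.integral_sub hgi hhi, norm_smul,
      Real.norm_of_nonneg (Real.exp_pos _).le]
    calc _ ≤ Real.exp (-(L * x)) * (M * dist g h * ((Real.exp (L * x) - 1) / L)) := by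
          rw [← hexpint]; exact mul_le_mul_of_nonneg_left hnorm (Real.exp_pos _).le
      _ = M / L * dist g h * (1 - Real.exp (-(L * x))) := by
          have : Real.exp (-(L * x)) * Real.exp (L * x) = 1 := by
            rw [← Real.exp_add]; simp
          linear_combination (M / L * dist g h) * this
      _ ≤ M / L * dist g h * 1 := by
          refine mul_le_mul_of_nonneg_left ?_ (by positivity)
          linarith [Real.exp_pos (-(L * x))]
      _ ≤ _ := by
          rw [mul_one]
          refine mul_le_mul_of_nonneg_right ?_ dist_nonneg
          simpa using hML
  have hctr : ContractingWith (1 / 2) T :=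
    ⟨by rw [← NNReal.coe_lt_coe]; norm_num, hLip⟩
  have : Nonempty C(Icc (0 : ℝ) b, E) := ⟨0⟩
  have hfix := hctr.fixedPoint_isFixedPt
  set g := ContractingWith.fixedPoint T hctr
  refine ⟨ext g, hext g, fun x hx => ?_⟩
  have h1 : g ⟨x, hx⟩ = _ := (DFunLike.congr_fun hfix ⟨x, hx⟩).symm.trans (hT g ⟨x, hx⟩)
  change Real.exp (L * x) • IccExtend hb g x = _
  rw [IccExtend_of_mem hb _ hx, h1, smul_smul, ← Real.exp_add]
  simp

end Analysis

/-! ### Pointwise estimates for trace-normalized non-negative matrices -/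

/-- A real symmetric non-negative `2 × 2` matrix of trace one, described by its entries. -/
structure IsTraceNormalized (M : Matrix (Fin 2) (Fin 2) ℝ) : Prop where
  symm : M 1 0 = M 0 1
  nonneg₀ : 0 ≤ M 0 0
  nonneg₁ : 0 ≤ M 1 1
  det_nonneg : M 0 1 ^ 2 ≤ M 0 0 * M 1 1
  trace : M 0 0 + M 1 1 = 1

lemma IsTraceNormalized.of_posSemidef {M : Matrix (Fin 2) (Fin 2) ℝ} (h : M.PosSemidef)
    (ht : M.trace = 1) : IsTraceNormalized M where
  symm := by simpa using h.1.apply 0 1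
  nonneg₀ := h.diag_nonneg
  nonneg₁ := h.diag_nonneg
  det_nonneg := by
    have h1 := h.det_nonneg
    have h2 : M 1 0 = M 0 1 := by simpa using h.1.apply 0 1
    rw [Matrix.det_fin_two, h2] at h1
    nlinarith
  trace := by simpa [Matrix.trace, Fin.sum_univ_two] using ht

section Pointwise

variable {H : ℝ → Matrix (Fin 2) (Fin 2) ℝ} {x : ℝ}

lemma cplx_mulVec_zero (v : Fin 2 → ℂ) :
    (cplx H x).mulVec v 0 = H x 0 0 * v 0 + H x 0 1 * v 1 := by
  simp [cplx, Matrix.mulVec, dotProduct, Fin.sum_univ_two]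

lemma cplx_mulVec_one (v : Fin 2 → ℂ) :
    (cplx H x).mulVec v 1 = H x 1 0 * v 0 + H x 1 1 * v 1 := by
  simp [cplx, Matrix.mulVec, dotProduct, Fin.sum_univ_two]

lemma form_eq (v w : Fin 2 → ℂ) : star v ⬝ᵥ (cplx H x).mulVec w =
    star (v 0) * (H x 0 0 * w 0 + H x 0 1 * w 1) +
      star (v 1) * (H x 1 0 * w 0 + H x 1 1 * w 1) := by
  rw [← cplx_mulVec_zero, ← cplx_mulVec_one]
  simp [dotProduct, Fin.sum_univ_two]

variable (h : IsTraceNormalized (H x))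
include h

lemma form_conj (v w : Fin 2 → ℂ) :
    star (star v ⬝ᵥ (cplx H x).mulVec w) = star w ⬝ᵥ (cplx H x).mulVec v := by
  rw [form_eq, form_eq, h.symm]
  simp
  ring

lemma form_self_re (v : Fin 2 → ℂ) : (star v ⬝ᵥ (cplx H x).mulVec v).re =
    H x 0 0 * ‖v 0‖ ^ 2 + 2 * H x 0 1 * ((v 0).re * (v 1).re + (v 0).im * (v 1).im) +
      H x 1 1 * ‖v 1‖ ^ 2 := by
  rw [form_eq, h.symm, Complex.sq_norm, Complex.sq_norm, Complex.normSq_apply,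
    Complex.normSq_apply]
  simp
  ring

lemma norm_mulVec_zero_sq_le (v : Fin 2 → ℂ) : ‖(cplx H x).mulVec v 0‖ ^ 2 ≤
    H x 0 0 * (star v ⬝ᵥ (cplx H x).mulVec v).re := by
  rw [form_self_re h, cplx_mulVec_zero, Complex.sq_norm, Complex.sq_norm, Complex.sq_norm,
    Complex.normSq_apply, Complex.normSq_apply, Complex.normSq_apply]
  simp
  nlinarith [mul_nonneg (sub_nonneg.2 h.det_nonneg)
    (add_nonneg (mul_self_nonneg (v 1).re) (mul_self_nonneg (v 1).im))]

lemma norm_mulVec_one_sq_le (v : Fin 2 → ℂ) : ‖(cplx H x).mulVec v 1‖ ^ 2 ≤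
    H x 1 1 * (star v ⬝ᵥ (cplx H x).mulVec v).re := by
  rw [form_self_re h, cplx_mulVec_one, h.symm, Complex.sq_norm, Complex.sq_norm, Complex.sq_norm,
    Complex.normSq_apply, Complex.normSq_apply, Complex.normSq_apply]
  simp
  nlinarith [mul_nonneg (sub_nonneg.2 h.det_nonneg)
    (add_nonneg (mul_self_nonneg (v 0).re) (mul_self_nonneg (v 0).im))]

lemma form_self_nonneg (v : Fin 2 → ℂ) : 0 ≤ (star v ⬝ᵥ (cplx H x).mulVec v).re := by
  have h0 := norm_mulVec_zero_sq_le h v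
  have h1 := norm_mulVec_one_sq_le h v
  have : (star v ⬝ᵥ (cplx H x).mulVec v).re = (H x 0 0 + H x 1 1) *
      (star v ⬝ᵥ (cplx H x).mulVec v).re := by rw [h.trace, one_mul]
  rw [this]
  nlinarith [sq_nonneg ‖(cplx H x).mulVec v 0‖, sq_nonneg ‖(cplx H x).mulVec v 1‖]

lemma norm_mulVec_sq_le (v : Fin 2 → ℂ) (i : Fin 2) : ‖(cplx H x).mulVec v i‖ ^ 2 ≤
    (star v ⬝ᵥ (cplx H x).mulVec v).re := by
  have hq := form_self_nonneg h v
  fin_cases i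
  · exact (norm_mulVec_zero_sq_le h v).trans
      (mul_le_of_le_one_left hq (by linarith [h.nonneg₁, h.trace]))
  · exact (norm_mulVec_one_sq_le h v).trans
      (mul_le_of_le_one_left hq (by linarith [h.nonneg₀, h.trace]))

lemma norm_mulVec_eq_zero {v : Fin 2 → ℂ} (hv : (star v ⬝ᵥ (cplx H x).mulVec v).re = 0) :
    (cplx H x).mulVec v = 0 := by
  ext i
  have := norm_mulVec_sq_le h v i
  rw [hv] at this
  simpa using pow_eq_zero_iff two_ne_zero |>.1 (le_antisymm this (sq_nonneg _))

lemma abs_offdiag_le : |H x 0 1| ≤ 1 := by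
  rw [← sq_le_one_iff_abs_le_one]
  nlinarith [h.det_nonneg, h.trace, h.nonneg₀, h.nonneg₁]

lemma norm_mulVec_le (v : Fin 2 → ℂ) : ‖(cplx H x).mulVec v‖ ≤ 2 * ‖v‖ := by
  have ho := abs_offdiag_le h
  have h0 : |H x 0 0| ≤ 1 := abs_le.2 ⟨by linarith [h.nonneg₀], by linarith [h.trace, h.nonneg₁]⟩
  have h1 : |H x 1 1| ≤ 1 := abs_le.2 ⟨by linarith [h.nonneg₁], by linarith [h.trace, h.nonneg₀]⟩
  have key : ∀ p q : ℝ, |p| ≤ 1 → |q| ≤ 1 → ‖(p : ℂ) * v 0 + q * v 1‖ ≤ 2 * ‖v‖ := by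
    intro p q hp hq
    refine (norm_add_le _ _).trans ?_
    rw [norm_mul, norm_mul, Complex.norm_real, Complex.norm_real, two_mul]
    exact add_le_add
      ((mul_le_of_le_one_left (norm_nonneg _) hp).trans (norm_le_pi_norm v 0))
      ((mul_le_of_le_one_left (norm_nonneg _) hq).trans (norm_le_pi_norm v 1))
  rw [pi_norm_le_iff_of_nonneg (by positivity)]
  intro i
  fin_cases i
  · simpa [cplx_mulVec_zero] using key _ _ h0 ho
  · simpa [cplx_mulVec_one, h.symm] using key _ _ ho h1

lemma form_self_le (v : Fin 2 → ℂ) : (star v ⬝ᵥ (cplx H x).mulVec v).re ≤ 2 * ‖v‖ ^ 2 := by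
  have h0 : ‖v 0‖ ^ 2 ≤ ‖v‖ ^ 2 := by gcongr; exact norm_le_pi_norm v 0
  have h1 : ‖v 1‖ ^ 2 ≤ ‖v‖ ^ 2 := by gcongr; exact norm_le_pi_norm v 1
  -- The value at `(v₀, v₁)` plus the value of the adjugate matrix is `|v₀|² + |v₁|²`.
  have h2 := form_self_nonneg h v
  have e := form_self_re h v
  have h3 : 0 ≤ H x 1 1 * ‖v 0‖ ^ 2 - 2 * H x 0 1 * ((v 0).re * (v 1).re + (v 0).im * (v 1).im) +
      H x 0 0 * ‖v 1‖ ^ 2 := by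
    have hadj : IsTraceNormalized (!![H x 1 1, -H x 0 1; -H x 0 1, H x 0 0]) :=
      ⟨by simp, by simpa using h.nonneg₁, by simpa using h.nonneg₀, by
        simpa [mul_comm] using h.det_nonneg, by simpa [add_comm] using h.trace⟩
    have := form_self_nonneg (H := fun _ => !![H x 1 1, -H x 0 1; -H x 0 1, H x 0 0]) (x := x)
      hadj v
    rw [form_self_re (H := fun _ => !![H x 1 1, -H x 0 1; -H x 0 1, H x 0 0]) hadj] at this
    simp at this
    linarith
  have h4 : H x 0 0 * ‖v 0‖ ^ 2 + H x 1 1 * ‖v 0‖ ^ 2 = ‖v 0‖ ^ 2 := by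
    rw [← add_mul, h.trace, one_mul]
  have h5 : H x 0 0 * ‖v 1‖ ^ 2 + H x 1 1 * ‖v 1‖ ^ 2 = ‖v 1‖ ^ 2 := by
    rw [← add_mul, h.trace, one_mul]
  linarith

omit h in
lemma form_add_smul_self (v w : Fin 2 → ℂ) (c : ℂ) :
    star (v + c • w) ⬝ᵥ (cplx H x).mulVec (v + c • w) =
      star v ⬝ᵥ (cplx H x).mulVec v + c * (star v ⬝ᵥ (cplx H x).mulVec w) +
      star c * (star w ⬝ᵥ (cplx H x).mulVec v) +
      star c * c * (star w ⬝ᵥ (cplx H x).mulVec w) := by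
  simp only [Matrix.mulVec_add, Matrix.mulVec_smul, star_add, star_smul, add_dotProduct,
    dotProduct_add, smul_dotProduct, dotProduct_smul, smul_eq_mul]
  ring

lemma norm_form_le (v w : Fin 2 → ℂ) : ‖star v ⬝ᵥ (cplx H x).mulVec w‖ ≤
    (star v ⬝ᵥ (cplx H x).mulVec v).re + (star w ⬝ᵥ (cplx H x).mulVec w).re := by
  have key : ∀ c : ℂ, star c * c = 1 → 0 ≤ (star v ⬝ᵥ (cplx H x).mulVec v).re +
      2 * (c * (star v ⬝ᵥ (cplx H x).mulVec w)).re + (star w ⬝ᵥ (cplx H x).mulVec w).re := by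
    intro c hc
    have h1 := form_self_nonneg h (v + c • w)
    rw [form_add_smul_self, hc, ← form_conj h v w, ← star_mul'] at h1
    simp only [Complex.add_re, one_mul, Complex.star_def, Complex.conj_re] at h1
    linarith
  have h1 := key 1 (by simp)
  have h2 := key (-1) (by simp)
  have h3 := key Complex.I (by simp)
  have h4 := key (-Complex.I) (by simp)
  simp only [one_mul, neg_mul, Complex.neg_re, Complex.I_mul_re, neg_neg] at h1 h2 h3 h4
  refine (Complex.norm_le_abs_re_add_abs_im _).trans ?_
  have h5 := abs_le.2 ⟨(by linarith : -(((star v ⬝ᵥ (cplx H x).mulVec v).re +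
    (star w ⬝ᵥ (cplx H x).mulVec w).re) / 2) ≤ (star v ⬝ᵥ (cplx H x).mulVec w).re), by linarith⟩
  have h6 := abs_le.2 ⟨(by linarith : -(((star v ⬝ᵥ (cplx H x).mulVec v).re +
    (star w ⬝ᵥ (cplx H x).mulVec w).re) / 2) ≤ (star v ⬝ᵥ (cplx H x).mulVec w).im), by linarith⟩
  linarith

end Pointwise

/-! ### The semi-inner product space of representatives -/

section L2

variable {H : ℝ → Matrix (Fin 2) (Fin 2) ℝ} {b : ℝ} (hH : IsHamiltonian H b)
include hH

lemma ae_isTraceNormalized :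
    ∀ᵐ x ∂volume.restrict (Ioo 0 b), IsTraceNormalized (H x) := by
  filter_upwards [hH.nonneg, hH.trace_eq_one] with x h1 h2 using .of_posSemidef h1 h2

lemma aestronglyMeasurable_mulVec {f : Fn}
    (hf : AEStronglyMeasurable f (volume.restrict (Ioo 0 b))) :
    AEStronglyMeasurable (fun x => (cplx H x).mulVec (f x)) (volume.restrict (Ioo 0 b)) := by
  have hHm : ∀ i j, AEStronglyMeasurable (fun x => (H x i j : ℂ)) (volume.restrict (Ioo 0 b)) :=
    fun i j => Complex.continuous_ofReal.comp_aestronglyMeasurable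
      (hH.integrable i j).aestronglyMeasurable
  have hc : ∀ i, AEStronglyMeasurable (fun x => f x i) (volume.restrict (Ioo 0 b)) :=
    fun i => (continuous_apply i).comp_aestronglyMeasurable hf
  refine (aemeasurable_pi_iff.2 fun i => ?_).aestronglyMeasurable
  fin_cases i
  · exact (((hHm 0 0).mul (hc 0)).add ((hHm 0 1).mul (hc 1))).aemeasurable.congr
      (Eventually.of_forall fun x => (cplx_mulVec_zero _).symm)
  · exact (((hHm 1 0).mul (hc 0)).add ((hHm 1 1).mul (hc 1))).aemeasurable.congr
      (Eventually.of_forall fun x => (cplx_mulVec_one _).symm)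

lemma aestronglyMeasurable_form {f g : Fn}
    (hf : AEStronglyMeasurable f (volume.restrict (Ioo 0 b)))
    (hg : AEStronglyMeasurable g (volume.restrict (Ioo 0 b))) :
    AEStronglyMeasurable (fun x => star (f x) ⬝ᵥ (cplx H x).mulVec (g x))
      (volume.restrict (Ioo 0 b)) := by
  have h1 := aestronglyMeasurable_mulVec hH hg
  have hc : ∀ (k : Fn) i, AEStronglyMeasurable k (volume.restrict (Ioo 0 b)) →
      AEStronglyMeasurable (fun x => k x i) (volume.restrict (Ioo 0 b)) :=
    fun k i hk => (continuous_apply i).comp_aestronglyMeasurable hk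
  refine (((hc f 0 hf).star.mul (hc _ 0 h1)).add ((hc f 1 hf).star.mul (hc _ 1 h1))).congr
    (Eventually.of_forall fun x => ?_)
  simp only [dotProduct, Fin.sum_univ_two, Pi.star_apply, Pi.add_apply, Pi.mul_apply]

lemma integrableOn_form {f g : Fn} (hf : MemL2 H b f) (hg : MemL2 H b g) :
    IntegrableOn (fun x => star (f x) ⬝ᵥ (cplx H x).mulVec (g x)) (Ioo 0 b) := by
  refine (hf.2.re.add hg.2.re).mono' (aestronglyMeasurable_form hH hf.1 hg.1) ?_
  filter_upwards [ae_isTraceNormalized hH] with x hx using norm_form_le hx _ _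

lemma memL2_of_bound {f : Fn} {C : ℝ}
    (hf : AEStronglyMeasurable f (volume.restrict (Ioo 0 b)))
    (hC : ∀ᵐ x ∂volume.restrict (Ioo 0 b), ‖f x‖ ≤ C) : MemL2 H b f := by
  refine ⟨hf, Integrable.mono' (g := fun _ => 2 * C ^ 2 + 2 * C ^ 2) (by simp)
    (aestronglyMeasurable_form hH hf hf) ?_⟩
  filter_upwards [ae_isTraceNormalized hH, hC] with x hx hCx
  have h1 := form_self_le hx (f x)
  have h2 : ‖f x‖ ^ 2 ≤ C ^ 2 := by gcongr
  exact (norm_form_le hx _ _).trans (by linarith)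

omit hH in
lemma innerL2_self_re_eq {f : Fn} (hf : MemL2 H b f) : (innerL2 H b f f).re =
    ∫ x in Ioo 0 b, (star (f x) ⬝ᵥ (cplx H x).mulVec (f x)).re :=
  (integral_re hf.2).symm

lemma innerL2_self_re_nonneg {f : Fn} (hf : MemL2 H b f) : 0 ≤ (innerL2 H b f f).re := by
  rw [innerL2_self_re_eq hf]
  refine integral_nonneg_of_ae ?_
  filter_upwards [ae_isTraceNormalized hH] with x hx using form_self_nonneg hx _

lemma innerL2_self_re_le_integral {f : Fn} {φ : ℝ → ℝ} (hf : MemL2 H b f)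
    (hφ : IntegrableOn φ (Ioo 0 b))
    (h : ∀ᵐ x ∂volume.restrict (Ioo 0 b), ‖f x‖ ^ 2 ≤ φ x) :
    (innerL2 H b f f).re ≤ 2 * ∫ x in Ioo 0 b, φ x := by
  rw [innerL2_self_re_eq hf, ← integral_const_mul]
  refine integral_mono_ae hf.2.re (hφ.const_mul 2) ?_
  filter_upwards [ae_isTraceNormalized hH, h] with x hx hx'
  exact (form_self_le hx _).trans (by simpa using hx')

lemma innerL2_self_re_le {f : Fn} {C : ℝ} (hb : 0 ≤ b) (hf : MemL2 H b f)
    (h : ∀ᵐ x ∂volume.restrict (Ioo 0 b), ‖f x‖ ≤ C) :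
    (innerL2 H b f f).re ≤ 2 * C ^ 2 * b := by
  have := innerL2_self_re_le_integral hH (φ := fun _ => C ^ 2) hf (by simp) (by
    filter_upwards [h] with x hx
    gcongr)
  simpa [hb, mul_comm, mul_left_comm, mul_assoc] using this

lemma innerL2_conj (f g : Fn) : star (innerL2 H b f g) = innerL2 H b g f := by
  unfold innerL2
  rw [Complex.star_def, ← integral_conj]
  refine integral_congr_ae ?_
  filter_upwards [ae_isTraceNormalized hH] with x hx using form_conj hx _ _

lemma memL2_add {f g : Fn} (hf : MemL2 H b f) (hg : MemL2 H b g) : MemL2 H b (f + g) := by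
  refine ⟨hf.1.add hg.1, ?_⟩
  refine (((hf.2.add (integrableOn_form hH hf hg)).add (integrableOn_form hH hg hf)).add
    hg.2).congr (Eventually.of_forall fun x => ?_)
  simpa using (form_add_smul_self (H := H) (x := x) (f x) (g x) 1).symm

omit hH in
lemma memL2_smul {f : Fn} (c : ℂ) (hf : MemL2 H b f) : MemL2 H b (c • f) := by
  refine ⟨hf.1.const_smul c, (hf.2.const_mul (star c * c)).congr
    (Eventually.of_forall fun x => ?_)⟩
  simp only [Pi.smul_apply, Matrix.mulVec_smul, star_smul, smul_dotProduct, dotProduct_smul,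
    smul_eq_mul]
  ring

lemma memL2_sub {f g : Fn} (hf : MemL2 H b f) (hg : MemL2 H b g) : MemL2 H b (f - g) := by
  simpa [sub_eq_add_neg] using memL2_add hH hf (memL2_smul (-1) hg)

lemma innerL2_add_left {f g k : Fn} (hf : MemL2 H b f) (hg : MemL2 H b g) (hk : MemL2 H b k) :
    innerL2 H b (f + g) k = innerL2 H b f k + innerL2 H b g k := by
  unfold innerL2
  rw [← integral_add (integrableOn_form hH hf hk) (integrableOn_form hH hg hk)]
  simp [add_dotProduct]

omit hH in
lemma innerL2_smul_left (f g : Fn) (c : ℂ) :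
    innerL2 H b (c • f) g = star c * innerL2 H b f g := by
  unfold innerL2
  rw [← integral_const_mul]
  simp

lemma innerL2_smul_right (f g : Fn) (c : ℂ) :
    innerL2 H b f (c • g) = c * innerL2 H b f g := by
  rw [← innerL2_conj hH, innerL2_smul_left, star_mul', star_star, innerL2_conj hH]

/-- The representatives of elements of `L²_H(b)`, as a subspace of all functions. -/
def subspaceL2 : Submodule ℂ Fn where
  carrier := {f | MemL2 H b f}
  add_mem' hf hg := memL2_add hH hf hg
  zero_mem' := memL2_of_bound hH (C := 0) aestronglyMeasurable_const (by simp)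
  smul_mem' c _ hf := memL2_smul c hf

/-- The semi-inner product of `L²_H(b)` on the space of representatives. -/
@[reducible]
noncomputable def coreL2 : PreInnerProductSpace.Core ℂ (subspaceL2 hH) where
  inner f g := innerL2 H b f g
  conj_inner_symm f g := innerL2_conj hH g f
  re_inner_nonneg f := innerL2_self_re_nonneg hH f.2
  add_left f g k := innerL2_add_left hH f.2 g.2 k.2
  smul_left f g c := innerL2_smul_left f g c

/-- **Bessel's inequality** in `L²_H(b)` for an orthogonal family. -/
lemma bessel {ι : Type*} (s : Finset ι) {e : ι → Fn} (he : ∀ i, MemL2 H b (e i))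
    (hpos : ∀ i, 0 < (innerL2 H b (e i) (e i)).re)
    (horth : ∀ i j, i ≠ j → innerL2 H b (e i) (e j) = 0) {f : Fn} (hf : MemL2 H b f) :
    ∑ i ∈ s, ‖innerL2 H b (e i) f‖ ^ 2 / (innerL2 H b (e i) (e i)).re ≤ (innerL2 H b f f).re := by
  let c := coreL2 hH
  let : SeminormedAddCommGroup (subspaceL2 hH) := 
    @InnerProductSpace.Core.toSeminormedAddCommGroup ℂ _ _ _ _ c
  let : InnerProductSpace ℂ (subspaceL2 hH) := InnerProductSpace.ofCore c
  set N : ι → ℝ := fun i => √(innerL2 H b (e i) (e i)).re with hN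
  have hNpos : ∀ i, 0 < N i := fun i => Real.sqrt_pos.2 (hpos i)
  have hNsq : ∀ i, N i ^ 2 = (innerL2 H b (e i) (e i)).re :=
    fun i => Real.sq_sqrt (hpos i).le
  let v : ι → subspaceL2 hH := fun i => ((N i)⁻¹ : ℂ) • ⟨e i, he i⟩
  have hinner : ∀ i (g : subspaceL2 hH), inner ℂ (v i) g = (N i)⁻¹ * innerL2 H b (e i) g := by
    intro i g
    change innerL2 H b (((N i)⁻¹ : ℂ) • e i) g = _
    rw [innerL2_smul_left]
    simp
  have hreal : ∀ i, innerL2 H b (e i) (e i) = ((N i ^ 2 : ℝ) : ℂ) := by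
    intro i
    rw [hNsq]
    exact (Complex.conj_eq_iff_re.1 (innerL2_conj hH (e i) (e i))).symm
  have hv : Orthonormal ℂ v := by
    classical
    rw [orthonormal_iff_ite]
    intro i j
    rw [hinner]
    change _ * innerL2 H b (e i) (((N j)⁻¹ : ℂ) • e j) = _
    rw [innerL2_smul_right hH]
    split_ifs with hij
    · subst hij
      have : (N i : ℂ) ≠ 0 := by exact_mod_cast (hNpos i).ne'
      rw [hreal]
      push_cast
      field_simp
    · rw [horth i j hij]; simp
  have hb := hv.sum_inner_products_le (x := (⟨f, hf⟩ : subspaceL2 hH)) (s := s)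
  have hnorm : ‖(⟨f, hf⟩ : subspaceL2 hH)‖ ^ 2 = (innerL2 H b f f).re := by
    rw [@norm_sq_eq_re_inner ℂ]; rfl
  rw [hnorm] at hb
  refine le_trans (le_of_eq (Finset.sum_congr rfl fun i _ => ?_)) hb
  rw [hinner, norm_mul, mul_pow, ← hNsq, Complex.norm_real, norm_inv,
    Real.norm_of_nonneg (hNpos i).le, inv_pow, div_eq_inv_mul]

/-- The **Cauchy–Schwarz inequality** in `L²_H(b)`. -/
lemma norm_innerL2_le {f g : Fn} (hf : MemL2 H b f) (hg : MemL2 H b g) :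
    ‖innerL2 H b f g‖ ≤ normL2 H b f * normL2 H b g := by
  let c := coreL2 hH
  let : SeminormedAddCommGroup (subspaceL2 hH) := 
    @InnerProductSpace.Core.toSeminormedAddCommGroup ℂ _ _ _ _ c
  let : InnerProductSpace ℂ (subspaceL2 hH) := InnerProductSpace.ofCore c
  exact norm_inner_le_norm (𝕜 := ℂ) (⟨f, hf⟩ : subspaceL2 hH) ⟨g, hg⟩

/-- Representatives of the same element have the same product with `H`. -/
lemma ae_mulVec_eq_of_eqL2 {f g : Fn} (hf : MemL2 H b f) (hg : MemL2 H b g)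
    (hfg : EqL2 H b f g) :
    ∀ᵐ x ∂volume.restrict (Ioo 0 b), (cplx H x).mulVec (f x) = (cplx H x).mulVec (g x) := by
  have hm := memL2_sub hH hf hg
  have h0 : (innerL2 H b (f - g) (f - g)).re = 0 := by
    have := innerL2_self_re_nonneg hH hm
    exact le_antisymm (Real.sqrt_eq_zero'.1 hfg) this
  rw [innerL2_self_re_eq hm] at h0
  have h1 := (integral_eq_zero_iff_of_nonneg_ae ?_ hm.2.re).1 h0
  · filter_upwards [ae_isTraceNormalized hH, h1] with x hx h0x
    have := norm_mulVec_eq_zero hx h0x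
    rwa [Pi.sub_apply, Matrix.mulVec_sub, sub_eq_zero] at this
  · filter_upwards [ae_isTraceNormalized hH] with x hx using form_self_nonneg hx _

lemma normL2_congr {f g : Fn} (h : ∀ᵐ x ∂volume.restrict (Ioo 0 b),
    (cplx H x).mulVec (f x) = (cplx H x).mulVec (g x)) : normL2 H b f = normL2 H b g := by
  have h1 : innerL2 H b f f = innerL2 H b f g := integral_congr_ae (by
    filter_upwards [h] with x hx
    rw [hx])
  have h2 : innerL2 H b g f = innerL2 H b g g := integral_congr_ae (by
    filter_upwards [h] with x hx
    rw [hx])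
  unfold normL2
  rw [h1, ← innerL2_conj hH, h2, Complex.star_def, Complex.conj_re]

/-- The indicator function of `[0, x]` in the direction of the `i`-th basis vector; pairing with
it integrates the `i`-th component of `H f` over `(0, x)`. -/
noncomputable def stepFn (x : ℝ) (i : Fin 2) : Fn := fun t => if t ≤ x then Pi.single i 1 else 0

omit hH in
lemma norm_stepFn_le (x t : ℝ) (i : Fin 2) : ‖stepFn x i t‖ ≤ 1 := by
  unfold stepFn
  split_ifs
  · exact (Pi.norm_single (G := fun _ => ℂ) (i := i) (1 : ℂ)).le.trans (by simp)
  · simp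

lemma memL2_stepFn (x : ℝ) (i : Fin 2) : MemL2 H b (stepFn x i) := by
  refine memL2_of_bound hH (C := 1) (StronglyMeasurable.aestronglyMeasurable ?_)
    (Eventually.of_forall fun t => norm_stepFn_le x t i)
  exact stronglyMeasurable_const.ite measurableSet_Iic stronglyMeasurable_const

lemma integrableOn_mulVec {g : Fn} (hg : MemL2 H b g) :
    IntegrableOn (fun t => (cplx H t).mulVec (g t)) (Ioo 0 b) := by
  refine Integrable.mono' (g := fun t => 1 + (star (g t) ⬝ᵥ (cplx H t).mulVec (g t)).re)
    ((integrable_const _).add hg.2.re) (aestronglyMeasurable_mulVec hH hg.1) ?_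
  filter_upwards [ae_isTraceNormalized hH] with x hx
  have h0 := form_self_nonneg hx (g x)
  rw [pi_norm_le_iff_of_nonneg (by positivity)]
  intro i
  have := norm_mulVec_sq_le hx (g x) i
  nlinarith [norm_nonneg ((cplx H x).mulVec (g x) i), sq_nonneg (‖(cplx H x).mulVec (g x) i‖ - 1)]

omit hH in
lemma innerL2_stepFn {g : Fn} {x : ℝ} (hx : x ∈ Icc 0 b) (i : Fin 2) :
    innerL2 H b (stepFn x i) g = ∫ t in (0 : ℝ)..x, (cplx H t).mulVec (g t) i := by
  rw [intervalIntegral.integral_of_le hx.1]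
  have h1 : ∀ t, star (stepFn x i t) ⬝ᵥ (cplx H t).mulVec (g t) =
      (Iic x).indicator (fun t => (cplx H t).mulVec (g t) i) t := by
    intro t
    by_cases ht : t ≤ x
    · rw [indicator_of_mem (show t ∈ Iic x from ht)]
      fin_cases i <;> simp [stepFn, ht, dotProduct, Fin.sum_univ_two]
    · rw [indicator_of_notMem (show t ∉ Iic x from ht)]
      simp [stepFn, ht]
  unfold innerL2
  simp_rw [h1]
  rw [← integral_Ioc_eq_integral_Ioo, setIntegral_indicator measurableSet_Iic]
  congr 2
  ext t
  simp only [mem_inter_iff, mem_Ioc, mem_Iic]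
  exact ⟨fun h => ⟨h.1.1, h.2⟩, fun h => ⟨⟨h.1, h.2.trans hx.2⟩, h.2⟩⟩

end L2

/-! ### Solutions of the canonical system -/

/-- The derivative `𝓙 H g` of a solution of `𝓙 f' = -H g`. -/
def rhs (H : ℝ → Matrix (Fin 2) (Fin 2) ℝ) (g : Fn) (t : ℝ) : Fin 2 → ℂ :=
  ![-(cplx H t).mulVec (g t) 1, (cplx H t).mulVec (g t) 0]

section Basic

variable {H : ℝ → Matrix (Fin 2) (Fin 2) ℝ} {b : ℝ}

lemma jmat_mulVec (v : Fin 2 → ℂ) : Jmat.mulVec v = ![-v 1, v 0] := by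
  ext i
  fin_cases i <;> simp [Jmat, Matrix.mulVec, dotProduct, Fin.sum_univ_two]

lemma jmat_mulVec_eq_iff {g : Fn} {x : ℝ} {v : Fin 2 → ℂ} :
    Jmat.mulVec v = -(cplx H x).mulVec (g x) ↔ v = rhs H g x := by
  rw [jmat_mulVec, rhs, funext_iff, funext_iff, Fin.forall_fin_two, Fin.forall_fin_two]
  simp only [Matrix.cons_val_zero, Matrix.cons_val_one, Pi.neg_apply, neg_inj]
  constructor
  · rintro ⟨h1, h2⟩; exact ⟨h2, h1⟩
  · rintro ⟨h1, h2⟩; exact ⟨h2, h1⟩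

lemma solvesWith_iff {f g : Fn} : SolvesWith H b f g ↔ AbsolutelyContinuousOnInterval f 0 b ∧
    ∀ᵐ x ∂volume.restrict (Ioo 0 b), HasDerivAt f (rhs H g x) x := by
  simp only [SolvesWith, jmat_mulVec_eq_iff, exists_eq_right]

lemma norm_rhs (g : Fn) (t : ℝ) : ‖rhs H g t‖ = ‖(cplx H t).mulVec (g t)‖ := by
  rw [rhs]
  generalize (cplx H t).mulVec (g t) = w
  simp [Pi.norm_def, Fin.univ_succ, sup_comm]

lemma rhs_congr {f g : Fn} {t : ℝ} (h : (cplx H t).mulVec (f t) = (cplx H t).mulVec (g t)) :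
    rhs H f t = rhs H g t := by
  rw [rhs, rhs, h]

lemma rhs_add_smul (f g : Fn) (c : ℂ) (t : ℝ) :
    rhs H (f + c • g) t = rhs H f t + c • rhs H g t := by
  ext i
  fin_cases i
  · simp [rhs, Matrix.mulVec_add, Matrix.mulVec_smul]
    ring
  · simp [rhs, Matrix.mulVec_add, Matrix.mulVec_smul]

lemma SolvesWith.add_smul {f g φ ψ : Fn} (c : ℂ) (hf : SolvesWith H b f φ)
    (hg : SolvesWith H b g ψ) : SolvesWith H b (f + c • g) (φ + c • ψ) := by
  rw [solvesWith_iff] at hf hg ⊢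
  refine ⟨hf.1.add (hg.1.const_smul c), ?_⟩
  filter_upwards [hf.2, hg.2] with x h1 h2
  rw [rhs_add_smul]
  exact h1.add (h2.const_smul c)

lemma SolvesWith.congr_right {f g ψ : Fn} (hf : SolvesWith H b f g)
    (h : ∀ᵐ x ∂volume.restrict (Ioo 0 b),
      (cplx H x).mulVec (g x) = (cplx H x).mulVec (ψ x)) : SolvesWith H b f ψ := by
  rw [solvesWith_iff] at hf ⊢
  refine ⟨hf.1, ?_⟩
  filter_upwards [hf.2, h] with x h1 h2
  rwa [← rhs_congr h2]

lemma SolvesWith.continuousOn {f g : Fn} (hb : 0 ≤ b) (h : SolvesWith H b f g) :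
    ContinuousOn f (Icc 0 b) := by
  simpa [uIcc_of_le hb] using h.1.continuousOn

lemma exists_norm_le_of_continuousOn {f : Fn} (hf : ContinuousOn f (Icc 0 b)) :
    ∃ C, ∀ x ∈ Icc 0 b, ‖f x‖ ≤ C :=
  isCompact_Icc.exists_bound_of_continuousOn hf

lemma aestronglyMeasurable_of_continuousOn {f : Fn} (hf : ContinuousOn f (Icc 0 b)) :
    AEStronglyMeasurable f (volume.restrict (Ioo 0 b)) :=
  (hf.mono Ioo_subset_Icc_self).aestronglyMeasurable measurableSet_Ioo

lemma ae_Ioo {p : ℝ → Prop} (h : ∀ x ∈ Icc 0 b, p x) : ∀ᵐ x ∂volume.restrict (Ioo 0 b), p x :=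
  (ae_restrict_iff' measurableSet_Ioo).2
    (Eventually.of_forall fun x hx => h x (Ioo_subset_Icc_self hx))

end Basic

section Equation

variable {H : ℝ → Matrix (Fin 2) (Fin 2) ℝ} {b : ℝ} (hH : IsHamiltonian H b) (hb : 0 ≤ b)
include hH hb

omit hb in
lemma memL2_of_continuousOn {f : Fn} (hf : ContinuousOn f (Icc 0 b)) : MemL2 H b f := by
  obtain ⟨C, hC⟩ := exists_norm_le_of_continuousOn hf
  exact memL2_of_bound hH (aestronglyMeasurable_of_continuousOn hf) (ae_Ioo hC)

lemma intervalIntegrable_rhs {g : Fn} (hg : MemL2 H b g) :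
    IntervalIntegrable (rhs H g) volume 0 b := by
  rw [intervalIntegrable_iff_integrableOn_Ioo_of_le hb]
  have h1 := integrableOn_mulVec hH hg
  refine h1.norm.mono' ?_ (Eventually.of_forall fun t => (norm_rhs g t).le)
  have h2 : Continuous fun v : Fin 2 → ℂ => (![-v 1, v 0] : Fin 2 → ℂ) := by
    refine continuous_pi fun i => ?_
    fin_cases i
    · exact (continuous_apply 1).neg
    · exact continuous_apply 0
  exact h2.comp_aestronglyMeasurable h1.aestronglyMeasurable

lemma SolvesWith.eq_integral {f g : Fn} (h : SolvesWith H b f g) (hg : MemL2 H b g) {x : ℝ}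
    (hx : x ∈ Icc 0 b) : f x = f 0 + ∫ t in (0 : ℝ)..x, rhs H g t :=
  ac_eq_primitive hb h.1 (intervalIntegrable_rhs hH hb hg)
    ((ae_restrict_iff' measurableSet_Ioo).1 (solvesWith_iff.1 h).2) hx

lemma solvesWith_of_eq_integral {f g : Fn} (y₀ : Fin 2 → ℂ) (hg : MemL2 H b g)
    (h : ∀ x ∈ Icc 0 b, f x = y₀ + ∫ t in (0 : ℝ)..x, rhs H g t) : SolvesWith H b f g := by
  have hi := intervalIntegrable_rhs hH hb hg
  rw [solvesWith_iff]
  refine ⟨ac_of_dist_le 1 (ac_primitive y₀ hi) fun x hx y hy => ?_, ?_⟩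
  · rw [uIcc_of_le hb] at hx hy
    rw [h x hx, h y hy, one_mul]
  · rw [ae_restrict_iff' measurableSet_Ioo]
    filter_upwards [hi.ae_hasDerivAt_integral] with x hx hxb
    have h1 := hx (by rw [uIcc_of_le hb]; exact Ioo_subset_Icc_self hxb) 0 left_mem_uIcc
    refine (h1.const_add y₀).congr_of_eventuallyEq ?_
    filter_upwards [Ioo_mem_nhds hxb.1 hxb.2] with t ht
    exact h t (Ioo_subset_Icc_self ht)

lemma integral_rhs {g : Fn} (hg : MemL2 H b g) {x : ℝ} (hx : x ∈ Icc 0 b) :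
    ∫ t in (0 : ℝ)..x, rhs H g t = ![-innerL2 H b (stepFn x 1) g, innerL2 H b (stepFn x 0) g] := by
  have hi : IntervalIntegrable (rhs H g) volume 0 x :=
    (intervalIntegrable_rhs hH hb hg).mono_set
      (uIcc_subset_uIcc_left (by rwa [uIcc_of_le hb]))
  have hp : ∀ i, (∫ t in (0 : ℝ)..x, rhs H g t) i = ∫ t in (0 : ℝ)..x, rhs H g t i := fun i =>
    ((ContinuousLinearMap.proj (R := ℝ) (φ := fun _ : Fin 2 => ℂ) i).intervalIntegral_comp_comm
      hi).symm
  ext i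
  rw [hp]
  fin_cases i
  · change ∫ t in (0 : ℝ)..x, -(cplx H t).mulVec (g t) 1 = -innerL2 H b (stepFn x 1) g
    rw [intervalIntegral.integral_neg, innerL2_stepFn hx]
  · exact (innerL2_stepFn hx 0).symm

/-- The first component of a solution is, up to its initial value, a bounded functional of the
right hand side. -/
lemma SolvesWith.apply_zero {f g : Fn} (h : SolvesWith H b f g) (hg : MemL2 H b g) {x : ℝ}
    (hx : x ∈ Icc 0 b) : f x 0 = f 0 0 - innerL2 H b (stepFn x 1) g := by
  rw [h.eq_integral hH hb hg hx, integral_rhs hH hb hg hx]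
  simp [sub_eq_add_neg]

/-- The second component of a solution is, up to its initial value, a bounded functional of the
right hand side. -/
lemma SolvesWith.apply_one {f g : Fn} (h : SolvesWith H b f g) (hg : MemL2 H b g) {x : ℝ}
    (hx : x ∈ Icc 0 b) : f x 1 = f 0 1 + innerL2 H b (stepFn x 0) g := by
  rw [h.eq_integral hH hb hg hx, integral_rhs hH hb hg hx]
  simp

lemma normL2_stepFn_le (x : ℝ) (i : Fin 2) : normL2 H b (stepFn x i) ≤ √(2 * b) := by
  refine Real.sqrt_le_sqrt ?_
  simpa using innerL2_self_re_le hH (C := 1) hb (memL2_stepFn hH x i)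
    (Eventually.of_forall fun t => norm_stepFn_le x t i)

lemma norm_integral_rhs_le {g : Fn} (hg : MemL2 H b g) {x : ℝ} (hx : x ∈ Icc 0 b) :
    ‖∫ t in (0 : ℝ)..x, rhs H g t‖ ≤ √(2 * b) * normL2 H b g := by
  have hn : ∀ i, ‖innerL2 H b (stepFn x i) g‖ ≤ √(2 * b) * normL2 H b g := fun i =>
    (norm_innerL2_le hH (memL2_stepFn hH x i) hg).trans
      (mul_le_mul_of_nonneg_right (normL2_stepFn_le hH hb x i) (Real.sqrt_nonneg _))
  rw [integral_rhs hH hb hg hx]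
  refine (pi_norm_le_iff_of_nonneg
    (mul_nonneg (Real.sqrt_nonneg _) (Real.sqrt_nonneg _))).2 fun i => ?_
  fin_cases i
  · exact (norm_neg _).le.trans (hn 1)
  · exact hn 0

/-- The a priori bound for the inhomogeneous equation `𝓙 f' = -H (h + z f)`. -/
lemma SolvesWith.norm_le {f h : Fn} {z : ℂ} (hf : SolvesWith H b f (h + z • f))
    (hh : MemL2 H b h) {x : ℝ} (hx : x ∈ Icc 0 b) :
    ‖f x‖ ≤ (‖f 0‖ + √(2 * b) * normL2 H b h) * Real.exp (2 * ‖z‖ * b) := by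
  have hfc := hf.continuousOn hb
  have hfm := memL2_of_continuousOn hH hfc
  have hg := memL2_add hH hh (memL2_smul z hfm)
  have hih := intervalIntegrable_rhs hH hb hh
  have hif := intervalIntegrable_rhs hH hb hfm
  have key := gronwall_integral (δ := ‖f 0‖ + √(2 * b) * normL2 H b h) (M := 2 * ‖z‖)
    (by positivity) hfc ?_ x hx
  · refine key.trans (mul_le_mul_of_nonneg_left ?_ (add_nonneg (norm_nonneg _)
      (mul_nonneg (Real.sqrt_nonneg _) (Real.sqrt_nonneg _))))
    exact Real.exp_le_exp.2 (mul_le_mul_of_nonneg_left hx.2 (by positivity))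
  · intro y hy
    have hsub : uIcc 0 y ⊆ uIcc 0 b := uIcc_subset_uIcc_left (by rwa [uIcc_of_le hb])
    have hfn : IntervalIntegrable (fun t => 2 * ‖f t‖) volume 0 y := by
      refine ContinuousOn.intervalIntegrable ?_
      rw [uIcc_of_le hb] at hsub
      exact continuousOn_const.mul (hfc.norm.mono hsub)
    have hzf : IntervalIntegrable (fun t => z • rhs H f t) volume 0 y :=
      (hif.mono_set hsub).smul z
    rw [hf.eq_integral hH hb hg hy]
    simp_rw [rhs_add_smul]
    rw [intervalIntegral.integral_add (hih.mono_set hsub) hzf, intervalIntegral.integral_smul,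
      ← add_assoc]
    refine (norm_add_le _ _).trans (add_le_add ((norm_add_le _ _).trans
      (add_le_add le_rfl (norm_integral_rhs_le hH hb hh hy))) ?_)
    rw [norm_smul, mul_comm 2 ‖z‖, mul_assoc, ← intervalIntegral.integral_const_mul]
    refine mul_le_mul_of_nonneg_left ?_ (norm_nonneg _)
    refine intervalIntegral.norm_integral_le_of_norm_le hy.1 ?_ hfn
    have h1 := (ae_restrict_iff' measurableSet_Ioo).1 (ae_isTraceNormalized hH)
    have h2 : ∀ᵐ t : ℝ, t ≠ b := by simp [ae_iff, measure_singleton]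
    filter_upwards [h1, h2] with t ht htb hty
    rw [norm_rhs]
    exact norm_mulVec_le (ht ⟨hty.1, lt_of_le_of_ne (hty.2.trans hy.2) htb⟩) _

lemma exists_solvesWith {h : Fn} (hh : MemL2 H b h) (z : ℂ) (y₀ : Fin 2 → ℂ) :
    ∃ f, SolvesWith H b f (h + z • f) ∧ f 0 = y₀ := by
  obtain ⟨f, hfc, hf⟩ := exists_integral_solution
    (F := fun t v => rhs H (h + z • fun _ => v) t) (M := 2 * ‖z‖) hb (by positivity)
    (fun g hg => intervalIntegrable_rhs hH hb (memL2_add hH hh (memL2_smul z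
      (memL2_of_continuousOn hH hg.continuousOn)))) (by
      rw [← ae_restrict_iff' measurableSet_Ioo]
      filter_upwards [ae_isTraceNormalized hH] with t ht v w
      have : rhs H (h + z • fun _ => v) t - rhs H (h + z • fun _ => w) t =
          z • rhs H (fun _ => v - w) t := by
        rw [show (fun _ : ℝ => v - w) = (fun _ => v) + (-1 : ℂ) • fun _ => w by
          ext t i; simp [sub_eq_add_neg], rhs_add_smul, rhs_add_smul, rhs_add_smul]
        module
      rw [this, norm_smul, norm_rhs]
      calc ‖z‖ * _ ≤ ‖z‖ * (2 * ‖v - w‖) :=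
            mul_le_mul_of_nonneg_left (norm_mulVec_le ht _) (norm_nonneg _)
        _ = _ := by ring) y₀
  refine ⟨f, solvesWith_of_eq_integral hH hb y₀ (memL2_add hH hh (memL2_smul z
      (memL2_of_continuousOn hH hfc.continuousOn))) hf, ?_⟩
  simpa using hf 0 (left_mem_Icc.2 hb)

lemma isFundamental_u (z : ℂ) : IsFundamental H b z (u H b z) := by
  refine Classical.epsilon_spec (p := IsFundamental H b z) ?_
  obtain ⟨f, hf, hf0⟩ := exists_solvesWith hH hb
    (h := 0) (memL2_of_continuousOn hH continuousOn_const) z ![1, 0]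
  exact ⟨f, by simpa using hf, hf0⟩

lemma continuousOn_u (z : ℂ) : ContinuousOn (u H b z) (Icc 0 b) :=
  (isFundamental_u hH hb z).1.continuousOn hb

lemma memL2_u (z : ℂ) : MemL2 H b (u H b z) :=
  memL2_of_continuousOn hH (continuousOn_u hH hb z)

lemma u_zero (z : ℂ) : u H b z 0 = ![1, 0] := (isFundamental_u hH hb z).2

lemma SolvesWith.norm_le_homogeneous {f : Fn} {z : ℂ} (hf : SolvesWith H b f (z • f)) {x : ℝ}
    (hx : x ∈ Icc 0 b) : ‖f x‖ ≤ ‖f 0‖ * Real.exp (2 * ‖z‖ * b) := by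
  have := SolvesWith.norm_le hH hb (h := 0) (z := z) (f := f) (by simpa using hf)
    (memL2_of_continuousOn hH continuousOn_const) hx
  simpa [normL2, innerL2] using this

lemma norm_u_le (z : ℂ) {x : ℝ} (hx : x ∈ Icc 0 b) :
    ‖u H b z x‖ ≤ Real.exp (2 * ‖z‖ * b) := by
  have := (isFundamental_u hH hb z).1.norm_le_homogeneous hH hb hx
  rw [u_zero hH hb] at this
  simpa [Pi.norm_def, Fin.univ_succ] using this

lemma IsFundamental.eq_u {y : Fn} {z : ℂ} (hy : IsFundamental H b z y) {x : ℝ}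
    (hx : x ∈ Icc 0 b) : y x = u H b z x := by
  have h1 := hy.1.add_smul (-1) (isFundamental_u hH hb z).1
  have h2 : SolvesWith H b (y + (-1 : ℂ) • u H b z) (z • (y + (-1 : ℂ) • u H b z)) := by
    convert h1 using 1
    module
  have h3 := h2.norm_le_homogeneous hH hb hx
  simp only [Pi.add_apply, Pi.smul_apply, hy.2, u_zero hH hb] at h3
  rw [show (![1, 0] : Fin 2 → ℂ) + (-1 : ℂ) • ![1, 0] = 0 by module, norm_zero, zero_mul,
    norm_le_zero_iff] at h3
  rw [← sub_eq_zero, ← h3]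
  module

/-- Since `H` is real, conjugation intertwines the spectral parameters `z` and `z*`. -/
lemma u_star (z : ℂ) {x : ℝ} (hx : x ∈ Icc 0 b) : u H b (star z) x = star (u H b z x) := by
  have hu := isFundamental_u hH hb z
  refine (IsFundamental.eq_u hH hb (y := fun x => star (u H b z x)) ⟨?_, ?_⟩ hx).symm
  · have h := solvesWith_iff.1 hu.1
    refine solvesWith_iff.2 ⟨ac_of_dist_le 1 h.1 fun x _ y _ => ?_, ?_⟩
    · rw [one_mul, dist_eq_norm, dist_eq_norm, ← star_sub, norm_star]
    · filter_upwards [h.2] with x hx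
      have h1 := hx.star
      have e : rhs H (star z • fun x => star (u H b z x)) x = star (rhs H (z • u H b z) x) := by
        ext i
        fin_cases i
        · change -(cplx H x).mulVec (star z • star (u H b z x)) 1 =
            star (-(cplx H x).mulVec (z • u H b z x) 1)
          rw [cplx_mulVec_one, cplx_mulVec_one]
          simp
        · change (cplx H x).mulVec (star z • star (u H b z x)) 0 =
            star ((cplx H x).mulVec (z • u H b z x) 0)
          rw [cplx_mulVec_zero, cplx_mulVec_zero]
          simp
      rw [e]
      exact h1
  · change star (u H b z 0) = _
    rw [hu.2]
    ext i
    fin_cases i <;> simp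

end Equation

/-! ### Green's identity -/

/-- The boundary form `f(x)* 𝓙 g(x)`. -/
def boundaryForm (f g : Fn) (x : ℝ) : ℂ := star (f x 0) * -g x 1 + star (f x 1) * g x 0

/-- The functional `f₁(b) sin γ - f₂(b) cos γ` whose kernel is the boundary condition at `b`. -/
noncomputable def boundaryValue (b γ : ℝ) (f : Fn) : ℂ :=
  f b 0 * (Real.sin γ : ℂ) - f b 1 * (Real.cos γ : ℂ)

lemma boundaryForm_eq_zero {b γ : ℝ} {f g : Fn} (hf : boundaryValue b γ f = 0)
    (hg : boundaryValue b γ g = 0) : boundaryForm f g b = 0 := by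
  have h1 : (Real.sin γ : ℂ) ^ 2 + (Real.cos γ : ℂ) ^ 2 = 1 := by
    exact_mod_cast Real.sin_sq_add_cos_sq γ
  have hf' := congrArg star hf
  simp only [boundaryValue, Complex.star_def, map_sub, map_mul, Complex.conj_ofReal,
    map_zero] at hf' hg
  simp only [boundaryForm, Complex.star_def]
  linear_combination (-(starRingEnd ℂ (f b 0) * (-g b 1) + starRingEnd ℂ (f b 1) * g b 0)) * h1 +
    (Real.cos γ * starRingEnd ℂ (f b 0) + Real.sin γ * starRingEnd ℂ (f b 1)) * hg -
    (Real.cos γ * g b 0 + Real.sin γ * g b 1) * hf'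

section Green

variable {H : ℝ → Matrix (Fin 2) (Fin 2) ℝ} {b : ℝ} (hH : IsHamiltonian H b) (hb : 0 ≤ b)
include hH hb

lemma green {f g φ ψ : Fn} (hf : SolvesWith H b f φ) (hg : SolvesWith H b g ψ)
    (hφ : MemL2 H b φ) (hψ : MemL2 H b ψ) :
    boundaryForm f g b - boundaryForm f g 0 = innerL2 H b φ g - innerL2 H b f ψ := by
  have hfm := memL2_of_continuousOn hH (hf.continuousOn hb)
  have hgm := memL2_of_continuousOn hH (hg.continuousOn hb)
  have i1 := integrableOn_form hH hφ hgm
  have i2 := integrableOn_form hH hfm hψ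
  have hac : ∀ (k : Fn) i, AbsolutelyContinuousOnInterval k 0 b →
      AbsolutelyContinuousOnInterval (fun x => k x i) 0 b := fun k i hk =>
    ac_of_dist_le 1 hk fun x _ y _ => by rw [one_mul]; exact dist_le_pi_dist (k x) (k y) i
  have hstar : ∀ k : ℝ → ℂ, AbsolutelyContinuousOnInterval k 0 b →
      AbsolutelyContinuousOnInterval (fun x => star (k x)) 0 b := fun k hk =>
    ac_of_dist_le 1 hk fun x _ y _ => by
      rw [one_mul, dist_eq_norm, dist_eq_norm, ← star_sub, norm_star]
  have hw : AbsolutelyContinuousOnInterval (boundaryForm f g) 0 b :=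
    ((hstar _ (hac f 0 hf.1)).smul (hac g 1 hg.1).neg).add
      ((hstar _ (hac f 1 hf.1)).smul (hac g 0 hg.1))
  have key := ac_eq_primitive hb hw (v := fun x => star (φ x) ⬝ᵥ (cplx H x).mulVec (g x) -
      star (f x) ⬝ᵥ (cplx H x).mulVec (ψ x)) ?_ ?_ (right_mem_Icc.2 hb)
  · rw [key, intervalIntegral.integral_of_le hb, integral_Ioc_eq_integral_Ioo,
      integral_sub i1 i2]
    unfold innerL2
    ring
  · rw [intervalIntegrable_iff_integrableOn_Ioo_of_le hb]
    exact i1.sub i2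
  · rw [← ae_restrict_iff' measurableSet_Ioo]
    filter_upwards [(solvesWith_iff.1 hf).2, (solvesWith_iff.1 hg).2, ae_isTraceNormalized hH]
      with x h1 h2 hx
    have h1' := fun i => hasDerivAt_pi.1 h1 i
    have h2' := fun i => hasDerivAt_pi.1 h2 i
    have hd := ((h1' 0).star.mul (h2' 1).neg).add ((h1' 1).star.mul (h2' 0))
    refine HasDerivAt.congr_deriv (f := boundaryForm f g) hd ?_
    rw [← form_conj hx (g x) (φ x)]
    simp only [rhs, dotProduct, Fin.sum_univ_two, Pi.star_apply, Pi.neg_apply,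
      Matrix.cons_val_zero, Matrix.cons_val_one, star_add, star_mul', star_star, star_neg]
    ring

/-- Green's identity for two solutions of the homogeneous equation normalized at `0`. -/
lemma green_u (z w : ℂ) : boundaryForm (u H b z) (u H b w) b =
    (star z - w) * innerL2 H b (u H b z) (u H b w) := by
  have h := green hH hb (isFundamental_u hH hb z).1 (isFundamental_u hH hb w).1
    (memL2_smul z (memL2_u hH hb z)) (memL2_smul w (memL2_u hH hb w))
  rw [innerL2_smul_left, innerL2_smul_right hH] at h
  have h0 : boundaryForm (u H b z) (u H b w) 0 = 0 := by
    simp [boundaryForm, u_zero hH hb]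
  rw [h0, sub_zero] at h
  rw [h]
  ring

end Green

/-! ### Cutting off a solution inside an interval where `H` is constant and invertible -/

section Cutoff

variable {a c : ℝ}

lemma R_cutoff_eq (hac : a < c) (x : ℝ) :
    R a (cutoff a c) x = max 0 (min 1 ((c - x) / (c - a))) := by
  have hpos : 0 < c - a := sub_pos.2 hac
  unfold R cutoff
  split_ifs with h1 h2
  · rw [min_eq_left ((one_le_div hpos).2 (by linarith)), max_eq_right zero_le_one]
  · rw [min_eq_right ((div_le_one hpos).2 (by linarith)),
      max_eq_right (div_nonneg (by linarith) hpos.le)]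
  · rw [max_eq_left ((min_le_right _ _).trans (div_nonpos_of_nonpos_of_nonneg (by linarith)
      hpos.le))]

lemma R_cutoff_mem (hac : a < c) (x : ℝ) : R a (cutoff a c) x ∈ Icc 0 1 := by
  rw [R_cutoff_eq hac]
  exact ⟨le_max_left _ _, max_le zero_le_one (min_le_left _ _)⟩

lemma norm_R_cutoff_smul_le (hac : a < c) (x : ℝ) (v : Fin 2 → ℂ) :
    ‖(R a (cutoff a c) x : ℂ) • v‖ ≤ ‖v‖ := by
  have h := R_cutoff_mem hac x
  rw [norm_smul, Complex.norm_real, Real.norm_of_nonneg h.1]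
  exact mul_le_of_le_one_left (norm_nonneg _) h.2

lemma R_cutoff_of_ge (hac : a < c) {x : ℝ} (hx : c ≤ x) : R a (cutoff a c) x = 0 := by
  rw [R_cutoff_eq hac, max_eq_left ((min_le_right _ _).trans
    (div_nonpos_of_nonpos_of_nonneg (by linarith) (sub_pos.2 hac).le))]

lemma lipschitzWith_R_cutoff (hac : a < c) :
    LipschitzWith (Real.toNNReal (1 / (c - a))) (R a (cutoff a c)) := by
  have hpos : 0 < c - a := sub_pos.2 hac
  have h1 : LipschitzWith (Real.toNNReal (1 / (c - a))) fun x : ℝ => (c - x) / (c - a) := by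
    refine LipschitzWith.of_dist_le_mul fun x y => le_of_eq ?_
    rw [Real.coe_toNNReal _ (by positivity), Real.dist_eq, Real.dist_eq, ← sub_div, abs_div,
      abs_of_pos hpos, show c - x - (c - y) = -(x - y) by ring, abs_neg]
    ring
  have h2 := (h1.const_min 1).const_max 0
  rwa [← funext (R_cutoff_eq hac)] at h2

/-- The derivative of the cutoff function, away from `a` and `c`. -/
lemma hasDerivAt_R_cutoff (hac : a < c) {x : ℝ} (hxa : x ≠ a) (hxc : x ≠ c) :
    HasDerivAt (R a (cutoff a c)) (if x ∈ Ioo a c then -(1 / (c - a)) else 0) x := by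
  rcases lt_or_gt_of_ne hxa with h | h
  · rw [if_neg (fun hx => absurd hx.1 h.not_gt)]
    refine (hasDerivAt_const x (1 : ℝ)).congr_of_eventuallyEq ?_
    filter_upwards [Iio_mem_nhds h] with t ht
    simp [R, le_of_lt (show t < a from ht)]
  · rcases lt_or_gt_of_ne hxc with h' | h'
    · rw [if_pos ⟨h, h'⟩]
      have hd : HasDerivAt (fun t : ℝ => (c - t) / (c - a)) (-(1 / (c - a))) x := by
        have := ((hasDerivAt_id x).const_sub c).div_const (c - a)
        exact this.congr_deriv (by ring)
      refine hd.congr_of_eventuallyEq ?_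
      filter_upwards [Ioo_mem_nhds h h'] with t ht
      simp [R, cutoff, not_le.2 ht.1, ht.2.le]
    · rw [if_neg (fun hx => absurd hx.2 h'.not_gt)]
      refine (hasDerivAt_const x (0 : ℝ)).congr_of_eventuallyEq ?_
      filter_upwards [Ioi_mem_nhds h'] with t ht
      exact R_cutoff_of_ge hac (le_of_lt ht)

/-- The cut-off function `R y`. -/
noncomputable def cutFn (a c : ℝ) (y : Fn) : Fn := fun x => (R a (cutoff a c) x : ℂ) • y x

/-- The function `g = z R y - R' H⁻¹ 𝓙 y`, for which `𝓙 (R y)' = -H g` when `𝓙 y' = -z H y`; on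
`(a, c)` the matrix `H` is `diag(1/2 + g₀, 1/2 - g₀)`. -/
noncomputable def cutRhs (p q a c : ℝ) (z : ℂ) (y : Fn) : Fn := fun x =>
  (R a (cutoff a c) x : ℂ) • z • y x +
    if x ∈ Ioo a c then
      ![-((1 / (c - a) / p : ℝ) : ℂ) * y x 1,
        ((1 / (c - a) / q : ℝ) : ℂ) * y x 0]
    else 0

lemma norm_cutRhs_le {p q : ℝ} (hp : 0 < p) (hq : 0 < q) (hac : a < c) (z : ℂ) (y : Fn)
    (x : ℝ) : ‖cutRhs p q a c z y x‖ ≤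
      (‖z‖ + (1 / (c - a) / p + 1 / (c - a) / q)) * ‖y x‖ := by
  replace hp : 0 < 1 / (c - a) / p := div_pos (one_div_pos.2 (sub_pos.2 hac)) hp
  replace hq : 0 < 1 / (c - a) / q := div_pos (one_div_pos.2 (sub_pos.2 hac)) hq
  unfold cutRhs
  generalize 1 / (c - a) / p = p' at hp
  generalize 1 / (c - a) / q = q' at hq
  rw [add_mul, ← norm_smul]
  refine (norm_add_le _ _).trans (add_le_add (norm_R_cutoff_smul_le hac x _) ?_)
  have h0 := norm_le_pi_norm (y x) 0
  have h1 := norm_le_pi_norm (y x) 1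
  have hn := norm_nonneg (y x)
  split_ifs
  · refine (pi_norm_le_iff_of_nonneg (by positivity)).2 fun i => ?_
    fin_cases i
    · change ‖-(p' : ℂ) * y x 1‖ ≤ _
      rw [norm_mul, norm_neg, Complex.norm_real, Real.norm_of_nonneg hp.le]
      nlinarith
    · change ‖(q' : ℂ) * y x 0‖ ≤ _
      rw [norm_mul, Complex.norm_real, Real.norm_of_nonneg hq.le]
      nlinarith
  · rw [norm_zero]; positivity

variable {H : ℝ → Matrix (Fin 2) (Fin 2) ℝ} {b p q : ℝ}

lemma solvesWith_cutFn (hp : 0 < p) (hq : 0 < q) (hac : a < c)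
    (hconst : ∀ᵐ x ∂volume.restrict (Ioo 0 b), x ∈ Ioo a c →
      H x = !![p, 0; 0, q])
    {y : Fn} {z : ℂ} (hy : SolvesWith H b y (z • y)) :
    SolvesWith H b (cutFn a c y) (cutRhs p q a c z y) := by
  rw [solvesWith_iff] at hy ⊢
  have hR : AbsolutelyContinuousOnInterval (fun x => (R a (cutoff a c) x : ℂ)) 0 b :=
    ac_of_dist_le 1
      (lipschitzWith_R_cutoff hac).lipschitzOnWith.absolutelyContinuousOnInterval
      fun x _ y _ => by rw [one_mul, dist_eq_norm, ← Complex.ofReal_sub, Complex.norm_real]; rfl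
  refine ⟨hR.smul hy.1, ?_⟩
  have h1 : ∀ᵐ x ∂volume.restrict (Ioo 0 b), x ≠ a :=
    ae_restrict_of_ae (by simp [ae_iff, measure_singleton])
  have h2 : ∀ᵐ x ∂volume.restrict (Ioo 0 b), x ≠ c :=
    ae_restrict_of_ae (by simp [ae_iff, measure_singleton])
  filter_upwards [hy.2, h1, h2, hconst] with x hx hxa hxc hHx
  have hd := (hasDerivAt_R_cutoff hac hxa hxc).ofReal_comp.smul hx
  have hp' : (p : ℂ) ≠ 0 := by exact_mod_cast hp.ne'
  have hq' : (q : ℂ) ≠ 0 := by exact_mod_cast hq.ne'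
  have hca : (c : ℂ) - a ≠ 0 := by exact_mod_cast (sub_pos.2 hac).ne'
  have e : rhs H (cutRhs p q a c z y) x = (R a (cutoff a c) x : ℂ) • rhs H (z • y) x +
      ((if x ∈ Ioo a c then -(1 / (c - a)) else 0 : ℝ) : ℂ) • y x := ?_
  · rw [e]
    exact hd
  by_cases hxI : x ∈ Ioo a c
  · have hH' := hHx hxI
    ext i
    fin_cases i
    · simp [rhs, cutRhs, hxI, cplx, hH', Matrix.mulVec, dotProduct, Fin.sum_univ_two]
      field_simp
      ring
    · simp [rhs, cutRhs, hxI, cplx, hH', Matrix.mulVec, dotProduct, Fin.sum_univ_two]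
      field_simp
  · ext i
    fin_cases i <;> simp [rhs, cutRhs, hxI, Matrix.mulVec_smul]

variable (hH : IsHamiltonian H b) (hp : 0 < p) (hq : 0 < q) (ha : 0 ≤ a) (hac : a < c)
  (hcb : c ≤ b)
  (hconst : ∀ᵐ x ∂volume.restrict (Ioo 0 b), x ∈ Ioo a c →
    H x = !![p, 0; 0, q])
include hH

lemma memL2_cutFn (hac : a < c) {y : Fn} (hy : ContinuousOn y (Icc 0 b)) :
    MemL2 H b (cutFn a c y) :=
  memL2_of_continuousOn hH
    ((Complex.continuous_ofReal.comp (lipschitzWith_R_cutoff hac).continuous).continuousOn.smul hy)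

include hp hq in
lemma memL2_cutRhs (hac : a < c) (z : ℂ) {y : Fn} (hy : ContinuousOn y (Icc 0 b)) :
    MemL2 H b (cutRhs p q a c z y) := by
  obtain ⟨C, hC⟩ := exists_norm_le_of_continuousOn hy
  have hm := aestronglyMeasurable_of_continuousOn hy
  have hca := sub_pos.2 hac
  refine memL2_of_bound hH ?_ (ae_Ioo fun x hx => (norm_cutRhs_le hp hq hac z y x).trans
    (mul_le_mul_of_nonneg_left (hC x hx) (by positivity)))
  refine (((Complex.continuous_ofReal.comp
    (lipschitzWith_R_cutoff hac).continuous).aestronglyMeasurable).smul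
    (hm.const_smul z)).add ?_
  have hc : Continuous fun v : Fin 2 → ℂ =>
      (![-((1 / (c - a) / p : ℝ) : ℂ) * v 1,
        ((1 / (c - a) / q : ℝ) : ℂ) * v 0] : Fin 2 → ℂ) := by
    refine continuous_pi fun i => ?_
    fin_cases i
    · exact continuous_const.mul (continuous_apply 1)
    · exact continuous_const.mul (continuous_apply 0)
  refine ((hc.comp_aestronglyMeasurable hm).indicator (measurableSet_Ioo (a := a) (b := c))).congr
    (Eventually.of_forall fun x => ?_)
  simp only [indicator_apply]

include hp hq ha hac hcb hconst

/-- Green's identity for a cut-off solution and `u(w, ·)`: there is no boundary term at `b`. -/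
lemma green_cutFn {y : Fn} {z : ℂ} (hy : SolvesWith H b y (z • y)) (w : ℂ) :
    innerL2 H b (cutRhs p q a c z y) (u H b w) - w * innerL2 H b (cutFn a c y) (u H b w) =
      -star (y 0 1) := by
  have hb : 0 ≤ b := ha.trans (hac.le.trans hcb)
  have h := green hH hb (solvesWith_cutFn hp hq hac hconst hy) (isFundamental_u hH hb w).1
    (memL2_cutRhs hH hp hq hac z (hy.continuousOn hb)) (memL2_smul w (memL2_u hH hb w))
  rw [innerL2_smul_right hH] at h
  have hRb : R a (cutoff a c) b = 0 := R_cutoff_of_ge hac hcb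
  have hR0 : R a (cutoff a c) 0 = 1 := if_pos ha
  rw [← h]
  simp [boundaryForm, cutFn, hRb, hR0, u_zero hH hb]

omit hp hq hconst in
lemma solvesWith_const : SolvesWith H b (fun _ => ![0, 1]) ((0 : ℂ) • fun _ => ![0, 1]) :=
  solvesWith_of_eq_integral hH (ha.trans (hac.le.trans hcb)) ![0, 1]
    (memL2_smul 0 (memL2_of_continuousOn hH continuousOn_const)) (by simp [rhs])

lemma innerL2_u_self_pos (w : ℂ) : 0 < (innerL2 H b (u H b w) (u H b w)).re := by
  have hb : 0 ≤ b := ha.trans (hac.le.trans hcb)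
  have hu := memL2_u hH hb w
  refine lt_of_le_of_ne (innerL2_self_re_nonneg hH hu) fun h0 => ?_
  have hn : normL2 H b (u H b w) = 0 := by rw [normL2, ← h0, Real.sqrt_zero]
  have hz : ∀ f, MemL2 H b f → innerL2 H b f (u H b w) = 0 := fun f hf => by
    have := norm_innerL2_le hH hf hu
    rwa [hn, mul_zero, norm_le_zero_iff] at this
  have h := green_cutFn hH hp hq ha hac hcb hconst (solvesWith_const hH ha hac hcb) w
  rw [hz _ (memL2_cutFn hH hac continuousOn_const),
    hz _ (memL2_cutRhs hH hp hq hac 0 continuousOn_const)] at h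
  simp at h

end Cutoff

/-! ### The spectrum and the reproducing kernel -/

section Spectrum

variable {H : ℝ → Matrix (Fin 2) (Fin 2) ℝ} {b : ℝ} (hH : IsHamiltonian H b) (hb : 0 ≤ b)
include hH hb

omit hH hb in
lemma eqL2_self (f : Fn) : EqL2 H b f f := by
  simp [EqL2, normL2, innerL2]

omit hH hb in
lemma boundaryValue_add_smul (γ : ℝ) (f g : Fn) (k : ℂ) :
    boundaryValue b γ (f + k • g) = boundaryValue b γ f + k * boundaryValue b γ g := by
  simp [boundaryValue]
  ring

omit hH hb in
lemma norm_boundaryValue_le (γ : ℝ) (f : Fn) : ‖boundaryValue b γ f‖ ≤ 2 * ‖f b‖ := by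
  unfold boundaryValue
  refine (norm_sub_le _ _).trans ?_
  rw [norm_mul, norm_mul, Complex.norm_real, Complex.norm_real, two_mul]
  exact add_le_add
    ((mul_le_of_le_one_right (norm_nonneg _) (Real.abs_sin_le_one γ)).trans (norm_le_pi_norm _ 0))
    ((mul_le_of_le_one_right (norm_nonneg _) (Real.abs_cos_le_one γ)).trans (norm_le_pi_norm _ 1))

/-- If `u(z, ·)` violates the boundary condition at `b`, then every inhomogeneous boundary value
problem is uniquely solvable, with an a priori bound. -/
lemma mem_resolventSet_of_boundaryValue_ne_zero {γ : ℝ} {z : ℂ}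
    (hz : boundaryValue b γ (u H b z) ≠ 0) : z ∈ resolventSet H b (relAγ H b γ) := by
  have hu := isFundamental_u hH hb z
  set θ := boundaryValue b γ (u H b z)
  have hθ : 0 < ‖θ‖ := norm_pos_iff.2 hz
  set E := Real.exp (2 * ‖z‖ * b)
  set B := √(2 * b) * E
  have hB : 0 ≤ B := by positivity
  set D := B + 2 * B / ‖θ‖ * E
  have hD : 0 ≤ D := by positivity
  refine ⟨√(2 * D ^ 2 * b), fun h hh => ⟨?_, ?_⟩⟩
  · obtain ⟨y, hy, hy0⟩ := exists_solvesWith hH hb hh z 0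
    set k : ℂ := -boundaryValue b γ y / θ
    have hf : SolvesWith H b (y + k • u H b z) (h + z • (y + k • u H b z)) := by
      convert hy.add_smul k hu.1 using 1
      module
    have hfm := memL2_of_continuousOn hH (hf.continuousOn hb)
    refine ⟨y + k • u H b z, y + k • u H b z,
      ⟨hfm, memL2_add hH hh (memL2_smul z hfm), eqL2_self _, hf, ?_⟩, ?_⟩
    · simp [hy0, hu.2]
    · change boundaryValue b γ _ = 0
      rw [boundaryValue_add_smul, div_mul_cancel₀ _ hz, add_neg_cancel]
  · rintro f ⟨f₀, hw, hbc⟩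
    set N := normL2 H b h
    have hN : 0 ≤ N := Real.sqrt_nonneg _
    have hf₀c := hw.solves.continuousOn hb
    have hf₀m := memL2_of_continuousOn hH hf₀c
    have hff₀ := ae_mulVec_eq_of_eqL2 hH hw.mem_left hf₀m hw.rep
    have hs : SolvesWith H b f₀ (h + z • f₀) := hw.solves.congr_right (by
      filter_upwards [hff₀] with x hx
      simp only [Pi.add_apply, Pi.smul_apply, Matrix.mulVec_add, Matrix.mulVec_smul, hx])
    -- Subtracting a multiple of `u(z, ·)` gives a solution that vanishes at `0`.
    set k := f₀ 0 0
    have hws : SolvesWith H b (f₀ + (-k) • u H b z) (h + z • (f₀ + (-k) • u H b z)) := by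
      convert hs.add_smul (-k) hu.1 using 1
      module
    have hw0 : (f₀ + (-k) • u H b z) 0 = 0 := by
      ext i
      fin_cases i
      · simp [hu.2, k]
      · simp [hu.2, hw.init]
    have hwle : ∀ x ∈ Icc 0 b, ‖(f₀ + (-k) • u H b z) x‖ ≤ B * N := fun x hx => by
      have := hws.norm_le hH hb hh hx
      rw [hw0, norm_zero, zero_add] at this
      exact this.trans (le_of_eq (by ring))
    have hk : ‖k‖ * ‖θ‖ ≤ 2 * (B * N) := by
      have h1 : boundaryValue b γ (f₀ + (-k) • u H b z) = -k * θ := by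
        rw [boundaryValue_add_smul, show boundaryValue b γ f₀ = 0 from hbc, zero_add]
      have h2 := norm_boundaryValue_le (b := b) γ (f₀ + (-k) • u H b z)
      rw [h1, norm_mul, norm_neg] at h2
      exact h2.trans (mul_le_mul_of_nonneg_left (hwle b (right_mem_Icc.2 hb)) zero_le_two)
    have hf₀le : ∀ x ∈ Icc 0 b, ‖f₀ x‖ ≤ D * N := fun x hx => by
      have h1 : f₀ x = (f₀ + (-k) • u H b z) x + k • u H b z x := by
        simp only [Pi.add_apply, Pi.smul_apply]
        module
      rw [h1]
      refine (norm_add_le _ _).trans ?_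
      rw [norm_smul]
      have h2 : ‖k‖ ≤ 2 * B / ‖θ‖ * N := by
        rw [div_mul_eq_mul_div, le_div_iff₀ hθ]
        exact hk.trans (le_of_eq (by ring))
      calc _ ≤ B * N + 2 * B / ‖θ‖ * N * E := add_le_add (hwle x hx)
            (mul_le_mul h2 (norm_u_le hH hb z hx) (norm_nonneg _) (by positivity))
        _ = _ := by ring
    rw [normL2_congr hH hff₀]
    calc normL2 H b f₀ ≤ √(2 * (D * N) ^ 2 * b) :=
          Real.sqrt_le_sqrt (innerL2_self_re_le hH hb hf₀m (ae_Ioo hf₀le))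
      _ = √(2 * D ^ 2 * b * N ^ 2) := by ring_nf
      _ = _ := by rw [Real.sqrt_mul (by positivity), Real.sqrt_sq hN]

lemma boundaryValue_u_eq_zero_of_mem_spectrumA {γ : ℝ} {z : ℂ} (hz : z ∈ spectrumA H b γ) :
    boundaryValue b γ (u H b z) = 0 :=
  not_not.1 fun h => hz (mem_resolventSet_of_boundaryValue_ne_zero hH hb h)

lemma star_eq_self_of_mem_spectrumA {γ : ℝ} {z : ℂ} (hz : z ∈ spectrumA H b γ)
    (hpos : 0 < (innerL2 H b (u H b z) (u H b z)).re) : star z = z := by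
  have h0 := boundaryValue_u_eq_zero_of_mem_spectrumA hH hb hz
  have h1 := green_u hH hb z z
  rw [boundaryForm_eq_zero h0 h0] at h1
  have h2 : innerL2 H b (u H b z) (u H b z) ≠ 0 := fun h => by simp [h] at hpos
  exact sub_eq_zero.1 ((mul_eq_zero.1 h1.symm).resolve_right h2)

/-- Eigenfunctions for different real eigenvalues are orthogonal. -/
lemma innerL2_u_u_eq_zero {γ : ℝ} {z w : ℂ} (hz : z ∈ spectrumA H b γ)
    (hw : w ∈ spectrumA H b γ) (hreal : star z = z) (hzw : z ≠ w) :
    innerL2 H b (u H b z) (u H b w) = 0 := by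
  have h1 := green_u hH hb z w
  rw [boundaryForm_eq_zero (boundaryValue_u_eq_zero_of_mem_spectrumA hH hb hz)
    (boundaryValue_u_eq_zero_of_mem_spectrumA hH hb hw), hreal] at h1
  exact (mul_eq_zero.1 h1.symm).resolve_left (sub_ne_zero.2 hzw)

lemma u_mem_closureDomA (z : ℂ) : u H b z ∈ closureDomA H b := by
  have hu := isFundamental_u hH hb z
  have hm := memL2_u hH hb z
  refine ⟨hm, fun ε hε => ⟨(u H b z, z • u H b z), ⟨u H b z, hm, memL2_smul z hm,
    eqL2_self _, hu.1, ?_⟩, ?_⟩⟩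
  · simp [hu.2]
  · rw [show normL2 H b (u H b z - u H b z) = 0 from eqL2_self _]
    exact hε

lemma U_eq_innerL2 (f : Fn) (w : ℂ) : U H b f w = innerL2 H b (u H b (star w)) f := by
  refine setIntegral_congr_fun measurableSet_Ioo fun x hx => ?_
  simp only [u_star hH hb w (Ioo_subset_Icc_self hx), star_star]

lemma isReproducingKernel_K : IsReproducingKernel H b (K H b) := by
  refine Classical.epsilon_spec (p := IsReproducingKernel H b)
    ⟨fun z w => U H b (u H b (star w)) z, fun w => ⟨u H b (star w),
      u_mem_closureDomA hH hb _, rfl, fun f _ => U_eq_innerL2 hH hb f w⟩⟩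

/-- On the real axis, `K_b(λ, λ) = ‖u(λ, ·)‖²`. -/
lemma K_self {w : ℂ} (hw : star w = w) : K H b w w = innerL2 H b (u H b w) (u H b w) := by
  obtain ⟨k, hk, hKk, hrep⟩ := isReproducingKernel_K hH hb w
  have h1 := hrep k hk
  have h2 := hrep _ (u_mem_closureDomA hH hb w)
  rw [U_eq_innerL2 hH hb, hw] at h1 h2
  have h3 : K H b w w = U H b k w := congrFun hKk w
  rw [h3, U_eq_innerL2 hH hb, hw, ← innerL2_conj hH, ← h2, innerL2_conj hH]

end Spectrum

/-! ### Bessel sums over the spectrum -/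

/-- A series of non-negative functions whose finite partial sums are dominated by `√(∑ w) * C`,
with `∑ w` convergent, converges, and it does so uniformly where `C` is bounded. -/
lemma summable_and_tendstoUniformlyOn {ι X : Type*} {φ : ι → X → ℝ} {w : ι → ℝ} {C : X → ℝ}
    (hφ : ∀ i x, 0 ≤ φ i x) (hw : ∀ i, 0 ≤ w i) (hC : ∀ x, 0 ≤ C x) (hsum : Summable w)
    (h : ∀ (s : Finset ι) x, ∑ i ∈ s, φ i x ≤ √(∑ i ∈ s, w i) * C x) :
    (∀ x, Summable fun i => φ i x) ∧ ∀ S : Set X, (∃ M, ∀ x ∈ S, C x ≤ M) →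
      TendstoUniformlyOn (fun (s : Finset ι) x => ∑ i ∈ s, φ i x)
        (fun x => ∑' i, φ i x) atTop S := by
  classical
  have hs : ∀ x, Summable fun i => φ i x := fun x =>
    summable_of_sum_le (fun i => hφ i x) (c := √(∑' i, w i) * C x) fun s =>
      (h s x).trans (mul_le_mul_of_nonneg_right
        (Real.sqrt_le_sqrt (hsum.sum_le_tsum s fun i _ => hw i)) (hC x))
  refine ⟨hs, ?_⟩
  rintro S ⟨M, hM⟩
  rw [Metric.tendstoUniformlyOn_iff]
  intro ε hε
  set M' := max M 0 + 1
  have hM' : 0 < M' := by positivity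
  obtain ⟨s₀, hs₀⟩ := summable_iff_vanishing_norm.1 hsum ((ε / (2 * M')) ^ 2) (by positivity)
  filter_upwards [eventually_ge_atTop s₀] with s hss₀ x hx
  have h1 : ∑ i ∈ s, φ i x ≤ ∑' i, φ i x := (hs x).sum_le_tsum s fun i _ => hφ i x
  have h2 : ∑' i, φ i x ≤ ∑ i ∈ s, φ i x + ε / 2 := by
    refine (hs x).tsum_le_of_sum_le fun t => ?_
    have hdisj : Disjoint (t \ s) s₀ := Finset.sdiff_disjoint.mono_right hss₀
    calc ∑ i ∈ t, φ i x ≤ ∑ i ∈ t ∪ s, φ i x :=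
          Finset.sum_le_sum_of_subset_of_nonneg Finset.subset_union_left fun i _ _ => hφ i x
      _ = ∑ i ∈ s, φ i x + ∑ i ∈ t \ s, φ i x := by
          rw [Finset.union_comm, ← Finset.union_sdiff_self_eq_union,
            Finset.sum_union Finset.disjoint_sdiff]
      _ ≤ _ := by
          gcongr
          refine (h (t \ s) x).trans ?_
          have h3 : √(∑ i ∈ t \ s, w i) ≤ ε / (2 * M') :=
            Real.sqrt_le_iff.2 ⟨by positivity, (le_abs_self _).trans (hs₀ _ hdisj).le⟩
          have h4 : C x ≤ M' := (hM x hx).trans ((le_max_left M 0).trans (by simp [M']))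
          calc _ ≤ ε / (2 * M') * M' := mul_le_mul h3 h4 (hC x) (by positivity)
            _ = ε / 2 := by field_simp
  rw [Real.dist_eq, abs_of_nonneg (sub_nonneg.2 h1)]
  linarith

section Sums

variable {H : ℝ → Matrix (Fin 2) (Fin 2) ℝ} {a b c p q γ : ℝ} (hH : IsHamiltonian H b)
  (hp : 0 < p) (hq : 0 < q) (ha : 0 ≤ a) (hac : a < c) (hcb : c ≤ b)
  (hconst : ∀ᵐ x ∂volume.restrict (Ioo 0 b), x ∈ Ioo a c → H x = !![p, 0; 0, q])
include hH

lemma norm_innerL2_comm (f g : Fn) : ‖innerL2 H b f g‖ = ‖innerL2 H b g f‖ := by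
  rw [← innerL2_conj hH, norm_star]

include ha hac hcb in
/-- The initial value `u₁(w, 0) = 1` and Green's identity for the cut-off of the constant
solution `(0, 1)` bound the Hilbert–Schmidt weight of `w` by two Fourier coefficients. -/
lemma weight_le (hp : 0 < p) (hq : 0 < q)
    (hconst : ∀ᵐ x ∂volume.restrict (Ioo 0 b), x ∈ Ioo a c → H x = !![p, 0; 0, q]) (w : ℂ) :
    1 / (1 + ‖w‖ ^ 2) ≤ ‖innerL2 H b (u H b w) (cutFn a c fun _ => ![0, 1])‖ ^ 2 +
      ‖innerL2 H b (u H b w) (cutRhs p q a c 0 fun _ => ![0, 1])‖ ^ 2 := by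
  have h := green_cutFn hH hp hq ha hac hcb hconst (solvesWith_const hH ha hac hcb) w
  rw [norm_innerL2_comm hH (u H b w), norm_innerL2_comm hH (u H b w), div_le_iff₀ (by positivity)]
  set F := innerL2 H b (cutFn a c fun _ => ![0, 1]) (u H b w)
  set G := innerL2 H b (cutRhs p q a c 0 fun _ => ![0, 1]) (u H b w)
  have h1 : (1 : ℝ) ≤ ‖G‖ + ‖w‖ * ‖F‖ := by
    have := norm_sub_le G (w * F)
    rw [h, norm_mul] at this
    simpa using this
  have h2 : 0 ≤ ‖G‖ + ‖w‖ * ‖F‖ := by positivity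
  nlinarith [sq_nonneg (‖F‖ - ‖w‖ * ‖G‖)]

lemma norm_u_sq_mul_weight_le (w : ℂ) {x : ℝ} (hx : x ∈ Icc 0 b) :
    1 / (1 + ‖w‖ ^ 2) * ‖u H b w x‖ ^ 2 ≤ 2 * (1 / (1 + ‖w‖ ^ 2)) +
      2 * ‖innerL2 H b (u H b w) (stepFn x 1)‖ ^ 2 +
      ‖innerL2 H b (u H b w) (stepFn x 0)‖ ^ 2 := by
  have hb : 0 ≤ b := hx.1.trans hx.2
  have hu := (isFundamental_u hH hb w).1
  have hm := memL2_smul w (memL2_u hH hb w)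
  rw [norm_innerL2_comm hH (u H b w), norm_innerL2_comm hH (u H b w)]
  have e0 : u H b w x 0 = 1 - w * innerL2 H b (stepFn x 1) (u H b w) := by
    rw [hu.apply_zero hH hb hm hx, innerL2_smul_right hH, u_zero hH hb]
    simp
  have e1 : u H b w x 1 = w * innerL2 H b (stepFn x 0) (u H b w) := by
    rw [hu.apply_one hH hb hm hx, innerL2_smul_right hH, u_zero hH hb]
    simp
  set F := innerL2 H b (stepFn x 1) (u H b w)
  set G := innerL2 H b (stepFn x 0) (u H b w)
  have h0 : ‖u H b w x 0‖ ^ 2 ≤ 2 + 2 * (‖w‖ ^ 2 * ‖F‖ ^ 2) := by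
    have := norm_sub_le 1 (w * F)
    rw [norm_one, norm_mul] at this
    rw [e0]
    calc _ ≤ (1 + ‖w‖ * ‖F‖) ^ 2 := by gcongr
      _ ≤ _ := by nlinarith [sq_nonneg (1 - ‖w‖ * ‖F‖)]
  have h1 : ‖u H b w x 1‖ ^ 2 = ‖w‖ ^ 2 * ‖G‖ ^ 2 := by rw [e1, norm_mul, mul_pow]
  have hsup : ‖u H b w x‖ ^ 2 ≤ ‖u H b w x 0‖ ^ 2 + ‖u H b w x 1‖ ^ 2 := by
    have : ‖u H b w x‖ ≤ √(‖u H b w x 0‖ ^ 2 + ‖u H b w x 1‖ ^ 2) := by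
      refine (pi_norm_le_iff_of_nonneg (Real.sqrt_nonneg _)).2 fun i => ?_
      refine Real.le_sqrt_of_sq_le ?_
      fin_cases i
      · exact le_add_of_nonneg_right (sq_nonneg _)
      · exact le_add_of_nonneg_left (sq_nonneg _)
    calc _ ≤ √(‖u H b w x 0‖ ^ 2 + ‖u H b w x 1‖ ^ 2) ^ 2 := by gcongr
      _ = _ := Real.sq_sqrt (by positivity)
  rw [one_div, inv_mul_le_iff₀ (by positivity)]
  have h3 : (1 + ‖w‖ ^ 2) * (2 * (1 + ‖w‖ ^ 2)⁻¹ + 2 * ‖F‖ ^ 2 + ‖G‖ ^ 2) =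
      2 + (1 + ‖w‖ ^ 2) * (2 * ‖F‖ ^ 2 + ‖G‖ ^ 2) := by
    field_simp
    ring
  rw [h3]
  nlinarith [sq_nonneg ‖F‖, sq_nonneg ‖G‖]

include hp hq ha hac hcb hconst

lemma bessel_u (s : Finset (spectrumA H b γ)) {f : Fn} (hf : MemL2 H b f) :
    ∑ μ ∈ s, ‖innerL2 H b (u H b μ) f‖ ^ 2 / (innerL2 H b (u H b μ) (u H b μ)).re ≤
      (innerL2 H b f f).re := by
  have hb : 0 ≤ b := ha.trans (hac.le.trans hcb)
  have hpos := innerL2_u_self_pos hH hp hq ha hac hcb hconst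
  exact bessel hH s (e := fun μ : spectrumA H b γ => u H b μ) (fun μ => memL2_u hH hb μ)
    (fun μ => hpos μ) (fun μ ν hμν => innerL2_u_u_eq_zero hH hb μ.2 ν.2
      (star_eq_self_of_mem_spectrumA hH hb μ.2 (hpos μ)) (Subtype.coe_injective.ne hμν)) hf

/-- The resolvents are Hilbert–Schmidt: the spectrum is square summable at infinity. -/
lemma summable_weight : Summable fun μ : spectrumA H b γ => 1 / (1 + ‖(μ : ℂ)‖ ^ 2) := by
  have hb : 0 ≤ b := ha.trans (hac.le.trans hcb)
  have hpos := innerL2_u_self_pos hH hp hq ha hac hcb hconst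
  have hm₁ : MemL2 H b (cutFn a c fun _ => ![0, 1]) := memL2_cutFn hH hac continuousOn_const
  have hm₂ : MemL2 H b (cutRhs p q a c 0 fun _ => ![0, 1]) :=
    memL2_cutRhs hH hp hq hac 0 continuousOn_const
  have hstep : ∀ x i, (innerL2 H b (stepFn x i) (stepFn x i)).re ≤ 2 * b := fun x i => by
    simpa using innerL2_self_re_le hH (C := 1) hb (memL2_stepFn hH x i)
      (Eventually.of_forall fun t => norm_stepFn_le x t i)
  set A := (innerL2 H b (cutFn a c fun _ => ![0, 1]) (cutFn a c fun _ => ![0, 1])).re +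
    (innerL2 H b (cutRhs p q a c 0 fun _ => ![0, 1]) (cutRhs p q a c 0 fun _ => ![0, 1])).re
  set D := 2 * A + 2 * (2 * b) + 2 * b
  refine summable_of_sum_le (c := 2 * (D * b)) (fun μ => by positivity) fun s => ?_
  set N : spectrumA H b γ → ℝ := fun μ => (innerL2 H b (u H b μ) (u H b μ)).re
  have hN : ∀ μ, 0 < N μ := fun μ => hpos μ
  set w : spectrumA H b γ → ℝ := fun μ => 1 / (1 + ‖(μ : ℂ)‖ ^ 2) with hw
  have hw0 : ∀ μ, 0 ≤ w μ := fun μ => by positivity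
  have hint : ∀ μ : spectrumA H b γ, IntegrableOn (fun x => ‖u H b μ x‖ ^ 2) (Ioo 0 b) :=
    fun μ => (((continuousOn_u hH hb μ).norm.pow 2).integrableOn_Icc).mono_set Ioo_subset_Icc_self
  have hA : ∑ μ ∈ s, w μ / N μ ≤ A := by
    have h1 := bessel_u hH hp hq ha hac hcb hconst s hm₁
    have h2 := bessel_u hH hp hq ha hac hcb hconst s hm₂
    refine le_trans ?_ (add_le_add h1 h2)
    rw [← Finset.sum_add_distrib]
    refine Finset.sum_le_sum fun μ _ => ?_
    rw [← add_div]
    exact div_le_div_of_nonneg_right (weight_le hH ha hac hcb hp hq hconst μ) (hN μ).le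
  have hpt : ∀ x ∈ Icc 0 b, ∑ μ ∈ s, w μ / N μ * ‖u H b μ x‖ ^ 2 ≤ D := fun x hx => by
    have h1 := (bessel_u hH hp hq ha hac hcb hconst s (memL2_stepFn hH x 1)).trans (hstep x 1)
    have h0 := (bessel_u hH hp hq ha hac hcb hconst s (memL2_stepFn hH x 0)).trans (hstep x 0)
    refine le_trans ?_ (add_le_add (add_le_add (mul_le_mul_of_nonneg_left hA zero_le_two)
      (mul_le_mul_of_nonneg_left h1 zero_le_two)) h0)
    rw [Finset.mul_sum, Finset.mul_sum, ← Finset.sum_add_distrib, ← Finset.sum_add_distrib]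
    refine Finset.sum_le_sum fun μ _ => ?_
    have := div_le_div_of_nonneg_right (norm_u_sq_mul_weight_le hH (μ : ℂ) hx) (hN μ).le
    calc _ = w μ * ‖u H b μ x‖ ^ 2 / N μ := by ring
      _ ≤ _ := this
      _ = _ := by simp only [hw, N]; ring
  calc ∑ μ ∈ s, w μ ≤ ∑ μ ∈ s, 2 * ∫ x in Ioo 0 b, w μ / N μ * ‖u H b μ x‖ ^ 2 := by
        refine Finset.sum_le_sum fun μ _ => ?_
        have := innerL2_self_re_le_integral hH (memL2_u hH hb μ) (hint μ)
          (Eventually.of_forall fun x => le_rfl)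
        rw [integral_const_mul]
        calc w μ = w μ / N μ * N μ := (div_mul_cancel₀ _ (hN μ).ne').symm
          _ ≤ w μ / N μ * (2 * ∫ x in Ioo 0 b, ‖u H b μ x‖ ^ 2) :=
            mul_le_mul_of_nonneg_left this (div_nonneg (hw0 μ) (hN μ).le)
          _ = _ := by ring
    _ = 2 * ∫ x in Ioo 0 b, ∑ μ ∈ s, w μ / N μ * ‖u H b μ x‖ ^ 2 := by
        rw [integral_finsetSum _ fun μ _ => (hint μ).const_mul _, Finset.mul_sum]
    _ ≤ 2 * ∫ x in Ioo 0 b, D := by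
        refine mul_le_mul_of_nonneg_left (setIntegral_mono_on
          (integrable_finsetSum _ fun μ _ => (hint μ).const_mul _) (by simp)
          measurableSet_Ioo fun x hx => hpt x (Ioo_subset_Icc_self hx)) zero_le_two
    _ = 2 * (D * b) := by simp [hb, mul_comm]

/-- The norm in `L²_H ⊕ L²_H` of the element `{R u(z*, ·), g}` of the relation. -/
noncomputable def cutNorm (H : ℝ → Matrix (Fin 2) (Fin 2) ℝ) (p q a b c : ℝ) (z : ℂ) : ℝ :=
  √((innerL2 H b (cutFn a c (u H b (star z))) (cutFn a c (u H b (star z)))).re +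
    (innerL2 H b (cutRhs p q a c (star z) (u H b (star z)))
      (cutRhs p q a c (star z) (u H b (star z)))).re)

/-- Since `R u(z*, ·)` lies in the domain of the relation, its Fourier coefficients gain a factor
that is square summable over the spectrum. -/
lemma sum_norm_Jker_le (s : Finset (spectrumA H b γ)) (z : ℂ) :
    ∑ μ ∈ s, ‖Jker H a b (cutoff a c) z μ‖ / √(K H b μ μ).re ≤
      √(∑ μ ∈ s, 1 / (1 + ‖(μ : ℂ)‖ ^ 2)) * cutNorm H p q a b c z := by
  have hb : 0 ≤ b := ha.trans (hac.le.trans hcb)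
  have hpos := innerL2_u_self_pos hH hp hq ha hac hcb hconst
  have hreal : ∀ μ : spectrumA H b γ, star (μ : ℂ) = μ := fun μ =>
    star_eq_self_of_mem_spectrumA hH hb μ.2 (hpos μ)
  set f := cutFn a c (u H b (star z))
  set g := cutRhs p q a c (star z) (u H b (star z))
  have hf : MemL2 H b f := memL2_cutFn hH hac (continuousOn_u hH hb _)
  have hg : MemL2 H b g := memL2_cutRhs hH hp hq hac _ (continuousOn_u hH hb _)
  set N : spectrumA H b γ → ℝ := fun μ => (innerL2 H b (u H b μ) (u H b μ)).re
  have hN : ∀ μ, 0 < N μ := fun μ => hpos μ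
  have hJ : ∀ μ : spectrumA H b γ, Jker H a b (cutoff a c) z μ = innerL2 H b f (u H b μ) := by
    intro μ
    unfold Jker innerL2
    rw [hreal]
    congr 1
    ext x
    simp only [f, cutFn, Matrix.mulVec_smul, star_smul, dotProduct_smul, smul_dotProduct,
      Complex.star_def, Complex.conj_ofReal]
  have hgreen : ∀ μ : spectrumA H b γ,
      innerL2 H b g (u H b μ) = μ * innerL2 H b f (u H b μ) := fun μ => by
    have := green_cutFn hH hp hq ha hac hcb hconst (isFundamental_u hH hb (star z)).1 μ
    rw [u_zero hH hb, Matrix.cons_val_one, Matrix.cons_val_fin_one, star_zero, neg_zero] at this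
    exact sub_eq_zero.1 this
  set r : spectrumA H b γ → ℝ := fun μ =>
    ‖innerL2 H b (u H b μ) f‖ ^ 2 / N μ + ‖innerL2 H b (u H b μ) g‖ ^ 2 / N μ
  have hr : ∀ μ, 0 ≤ r μ := fun μ =>
    add_nonneg (div_nonneg (sq_nonneg _) (hN μ).le) (div_nonneg (sq_nonneg _) (hN μ).le)
  have hterm : ∀ μ : spectrumA H b γ, ‖Jker H a b (cutoff a c) z μ‖ / √(K H b μ μ).re =
      √(1 / (1 + ‖(μ : ℂ)‖ ^ 2)) * √(r μ) := fun μ => by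
    have h1 : r μ = (1 + ‖(μ : ℂ)‖ ^ 2) * (‖innerL2 H b f (u H b μ)‖ ^ 2 / N μ) := by
      simp only [r]
      rw [norm_innerL2_comm hH (u H b μ) f, norm_innerL2_comm hH (u H b μ) g, hgreen, norm_mul]
      ring
    have h2 : 0 < 1 + ‖(μ : ℂ)‖ ^ 2 := by positivity
    rw [hJ, K_self hH hb (hreal μ), ← Real.sqrt_mul (by positivity), h1, ← mul_assoc,
      one_div_mul_cancel h2.ne', one_mul, Real.sqrt_div (sq_nonneg _),
      Real.sqrt_sq (norm_nonneg _)]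
  have hsum : ∑ μ ∈ s, r μ ≤ (innerL2 H b f f).re + (innerL2 H b g g).re := by
    rw [Finset.sum_add_distrib]
    exact add_le_add (bessel_u hH hp hq ha hac hcb hconst s hf)
      (bessel_u hH hp hq ha hac hcb hconst s hg)
  simp_rw [hterm]
  calc _ ≤ √(∑ μ ∈ s, 1 / (1 + ‖(μ : ℂ)‖ ^ 2)) * √(∑ μ ∈ s, r μ) :=
        Real.sum_sqrt_mul_sqrt_le s (fun μ => by positivity) hr
    _ ≤ _ := mul_le_mul_of_nonneg_left (Real.sqrt_le_sqrt hsum) (Real.sqrt_nonneg _)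

omit hconst in
lemma cutNorm_bounded {S : Set ℂ} (hS : Bornology.IsBounded S) :
    ∃ M, ∀ z ∈ S, cutNorm H p q a b c z ≤ M := by
  have hb : 0 ≤ b := ha.trans (hac.le.trans hcb)
  have hca := sub_pos.2 hac
  obtain ⟨M, hM⟩ := hS.exists_norm_le
  set κ := 1 / (c - a) / p + 1 / (c - a) / q
  have hκ : 0 ≤ κ := by positivity
  set E := Real.exp (2 * M * b)
  refine ⟨√(2 * E ^ 2 * b + 2 * ((M + κ) * E) ^ 2 * b), fun z hz => Real.sqrt_le_sqrt ?_⟩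
  have hzM := hM z hz
  have hu : ∀ x ∈ Icc 0 b, ‖u H b (star z) x‖ ≤ E := fun x hx =>
    (norm_u_le hH hb _ hx).trans (Real.exp_le_exp.2 (by rw [norm_star]; gcongr))
  refine add_le_add (innerL2_self_re_le hH hb (memL2_cutFn hH hac (continuousOn_u hH hb _))
    (ae_Ioo fun x hx => (norm_R_cutoff_smul_le hac x _).trans (hu x hx)))
    (innerL2_self_re_le hH hb (memL2_cutRhs hH hp hq hac _ (continuousOn_u hH hb _))
    (ae_Ioo fun x hx => (norm_cutRhs_le hp hq hac _ _ x).trans ?_))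
  rw [norm_star]
  have := (norm_nonneg z).trans hzM
  exact mul_le_mul (by gcongr) (hu x hx) (norm_nonneg _) (by positivity)

end Sums

end CanonicalSystem

open CanonicalSystem in
theorem proposition4p1
    (b : ℝ) (H : ℝ → Matrix (Fin 2) (Fin 2) ℝ) (hH : IsHamiltonian H b)
    (x₁ x₂ g₀ : ℝ) (hx₁ : 0 ≤ x₁) (hx₂ : x₂ ≤ b)
    (hg₀ : g₀ ∈ Set.Ioo (-1 / 2 : ℝ) (1 / 2))
    (hconst : ∀ᵐ x ∂MeasureTheory.volume.restrict (Set.Icc x₁ x₂),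
      H x = !![1 / 2 + g₀, 0; 0, 1 / 2 - g₀])
    (a c : ℝ) (ha : a ∈ Set.Ico x₁ x₂) (hc : c ∈ Set.Ioc a x₂)
    (γ : ℝ) (hγ : γ ∈ Set.Ico 0 Real.pi) :
    (∀ z : ℂ, Summable (fun μ : spectrumA H b γ =>
      ‖Jker H a b (cutoff a c) z μ‖ / √(K H b μ μ).re)) ∧
    ∀ 𝕂 : Set ℂ, IsCompact 𝕂 →
      TendstoUniformlyOn
        (fun (s : Finset (spectrumA H b γ)) (z : ℂ) =>
          ∑ μ ∈ s, ‖Jker H a b (cutoff a c) z μ‖ / √(K H b μ μ).re)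
        (fun z : ℂ => ∑' μ : spectrumA H b γ,
          ‖Jker H a b (cutoff a c) z μ‖ / √(K H b μ μ).re)
        Filter.atTop 𝕂 := by
  have hp : 0 < 1 / 2 + g₀ := by linarith [hg₀.1]
  have hq : 0 < 1 / 2 - g₀ := by linarith [hg₀.2]
  have ha₀ : 0 ≤ a := hx₁.trans ha.1
  have hcb : c ≤ b := hc.2.trans hx₂
  have hconst' : ∀ᵐ x ∂volume.restrict (Ioo 0 b), x ∈ Ioo a c →
      H x = !![1 / 2 + g₀, 0; 0, 1 / 2 - g₀] := by
    refine ae_restrict_of_ae ?_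
    filter_upwards [(ae_restrict_iff' measurableSet_Icc).1 hconst] with x hx hxac
    exact hx ⟨ha.1.trans hxac.1.le, hxac.2.le.trans hc.2⟩
  have key := summable_and_tendstoUniformlyOn
    (φ := fun (μ : spectrumA H b γ) z => ‖Jker H a b (cutoff a c) z μ‖ / √(K H b μ μ).re)
    (C := cutNorm H (1 / 2 + g₀) (1 / 2 - g₀) a b c)
    (fun _ _ => div_nonneg (norm_nonneg _) (Real.sqrt_nonneg _)) (fun _ => by positivity)
    (fun _ => Real.sqrt_nonneg _)
    (summable_weight hH hp hq ha₀ hc.1 hcb hconst')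
    (sum_norm_Jker_le hH hp hq ha₀ hc.1 hcb hconst')
  exact ⟨key.1, fun S hS => key.2 S (cutNorm_bounded hH hp hq ha₀ hc.1 hcb hS.isBounded)⟩
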